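/- Let $G$ be a Lie group with Lie algebra $\mathfrak g$, let $H\subset G$ be a closed subgroup with Lie algebra $\mathfrak h$, and let $G/H$ carry its quotient manifold structure (the one for which the projection $\pi:G\to G/H$ is a smooth submersion). Let $F:T(G/H)\to[0,\infty)$ be a $G$-invariant Finsler metric: $F$ is continuous, smooth off the zero section, positively homogeneous of degree one, and for every $y\neq 0$ in a tangent space $T_x$ the form $g_y(u,v)=\frac12\frac{\partial^2}{\partial s\,\partial t}F^2(x,y+su+tv)\big|_{s=t=0}$ is positive definite on $T_x$. Put $C_y(u,v,w)=\frac12\frac{d}{dt}g_{y+tw}(u,v)\big|_{t=0}$. Assume that $(G/H,F)$ is naturally reductive: there is a vector space decomposition $\mathfrak g=\mathfrak h\oplus\mathfrak m$ with $\mathrm{Ad}(H)\mathfrak m\subset\mathfrak m$ such that $$g_y([x,u]_{\mathfrak m},v)+g_y(u,[x,v]_{\mathfrak m})+2C_y([x,y]_{\mathfrak m},u,v)=0\qquad\text{for all }x,y,u,v\in\mathfrak m,\ y\neq0,$$ where $\mathfrak m$ is identified with the tangent space of $G/H$ at the origin $\pi(e)$ by $d\pi$ and the subscript $\mathfrak m$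 denotes the projection onto $\mathfrak m$ along $\mathfrak h$. Then every geodesic of $(G/H,F)$ is an orbit of a one-parameter group of isometries $\{\exp(tX)\}$ with $X\in\mathfrak g$. Precisely, let $J\subset\mathbb R$ be an interval with more than one point and let $\gamma:J\to G/H$ be a geodesic, that is, a smooth curve with nowhere vanishing velocity that satisfies in local coordinates $$\ddot x^i+2G^i(x,\dot x)=0,\qquad G^i(x,y)=\tfrac14 g^{il}(x,y)\Big(2\frac{\partial g_{sl}}{\partial x^k}(x,y)-\frac{\partial g_{sk}}{\partial x^l}(x,y)\Big)y^sy^k,$$ where $g_{ij}=\frac12\,\partial^2F^2/\partial y^i\partial y^j$. Then there are $X\in\mathfrak g$ and $p\in G/H$ such that $\gamma(t)=\exp(tX)\cdot p$ for all $t\in J$, where each $\exp(tX)$ acts by an isometry and the whole orbit $t\mapsto\exp(tX)\cdot p$, $t\in\mathbb R$, is a geodesic. -/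

import Mathlib

open scoped Manifold ContDiff

noncomputable section

namespace FinslerHomogeneous

/-! ### Minkowski norms: fundamental tensor and Cartan tensor -/

section Minkowski

variable {V : Type*} [AddCommGroup V] [Module ℝ V]

/-- The fundamental tensor of a function `φ` on a vector space (a Minkowski norm) at `y`:
`g_y(u, v) = (1/2) ∂²/∂s∂t [φ²(y + s u + t v)]` at `s = t = 0`. -/
def fundamentalForm (φ : V → ℝ) (y u v : V) : ℝ :=
  (1 / 2) * deriv (fun s : ℝ => deriv (fun t : ℝ => φ (y + s • u + t • v) ^ 2) 0) 0

/-- The Cartan tensor `C_y(u, v, w) = (1/2) d/dt [g_{y + t w}(u, v)]` at `t = 0`. -/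
def cartanForm (φ : V → ℝ) (y u v w : V) : ℝ :=
  (1 / 2) * deriv (fun t : ℝ => fundamentalForm φ (y + t • w) u v) 0

end Minkowski

/-! ### Finsler metrics, isometries and geodesics -/

section Finsler

variable {E : Type*} [NormedAddCommGroup E] [NormedSpace ℝ E]
  {M : Type*} [TopologicalSpace M] [ChartedSpace E M]

/-- The restriction of `F : TM → ℝ` to the tangent space at `x`. -/
def fiber (F : TangentBundle 𝓘(ℝ, E) M → ℝ) (x : M) : TangentSpace 𝓘(ℝ, E) x → ℝ :=
  fun y => F ⟨x, y⟩

/-- `F` is a (positively homogeneous) Finsler metric on `M`: it is continuous and nonnegative on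
`TM`, smooth off the zero section, positively homogeneous of degree one, and `g_y` is positive
definite for all `y ≠ 0`. -/
structure IsFinslerMetric [IsManifold 𝓘(ℝ, E) ∞ M] (F : TangentBundle 𝓘(ℝ, E) M → ℝ) : Prop where
  continuous : Continuous F
  nonneg : ∀ v, 0 ≤ F v
  smooth : ContMDiffOn (𝓘(ℝ, E).tangent) 𝓘(ℝ, ℝ) ∞ F {v | v.2 ≠ 0}
  homogeneous : ∀ (x : M) (y : TangentSpace 𝓘(ℝ, E) x) (t : ℝ), 0 ≤ t →
    F ⟨x, t • y⟩ = t * F ⟨x, y⟩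
  posDef : ∀ (x : M) (y u : TangentSpace 𝓘(ℝ, E) x), y ≠ 0 → u ≠ 0 →
    0 < fundamentalForm (fiber F x) y u u

/-- A smooth map `f : M → M` whose differential preserves the Finsler metric `F`. -/
structure IsIsometricMap (F : TangentBundle 𝓘(ℝ, E) M → ℝ) (f : M → M) : Prop where
  smooth : ContMDiff 𝓘(ℝ, E) 𝓘(ℝ, E) ∞ f
  preserves : ∀ v : TangentBundle 𝓘(ℝ, E) M, F (tangentMap 𝓘(ℝ, E) 𝓘(ℝ, E) f v) = F v

/-- The function `F(x, y)` in the natural coordinates `(x, y)` of `TM` that come from the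
preferred chart at `q`. -/
def localF (F : TangentBundle 𝓘(ℝ, E) M → ℝ) (q : M) (x : E) : E → ℝ :=
  fun y => F (tangentMap 𝓘(ℝ, E) 𝓘(ℝ, E) (extChartAt 𝓘(ℝ, E) q).symm ⟨x, y⟩)

/-- The fundamental tensor `g_{(x, y)}(u, v) = g_{ij}(x, y) uⁱ vʲ` in these coordinates. -/
def localG (F : TangentBundle 𝓘(ℝ, E) M → ℝ) (q : M) (x y u v : E) : ℝ :=
  fundamentalForm (localF F q x) y u v

/-- The equation `ẍⁱ + 2 Gⁱ(x, ẋ) = 0` of the geodesics of constant speed, where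
`Gⁱ = (1/4) gⁱˡ (2 ∂g_{sl}/∂xᵏ - ∂g_{sk}/∂xˡ) yˢ yᵏ` are the spray coefficients of `F`.
It is written with its index lowered by the (nondegenerate) fundamental tensor, that is, as
`g_{il} ẍⁱ + (1/2) (2 ∂g_{sl}/∂xᵏ - ∂g_{sk}/∂xˡ) yˢ yᵏ = 0`, paired with an arbitrary `w`.
The position is `x`, the velocity is `y`, the acceleration is `a`. -/
def GeodesicEquation (F : TangentBundle 𝓘(ℝ, E) M → ℝ) (q : M) (x y a : E) : Prop :=
  ∀ w : E,
    localG F q x y a w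
      + (1 / 2) * (2 * fderiv ℝ (fun x' : E => localG F q x' y y w) x y
        - fderiv ℝ (fun x' : E => localG F q x' y y y) x w) = 0

/-- `γ` is a geodesic of `F`, parametrized with constant nonzero speed, on the nondegenerate
interval `J` (of any type: open, half-open, closed, bounded or not): a smooth curve with nowhere
vanishing velocity that satisfies the geodesic equation in the charts of `M`. -/
structure IsGeodesicOn (F : TangentBundle 𝓘(ℝ, E) M → ℝ) (J : Set ℝ) (γ : ℝ → M) : Prop where
  ordConnected : J.OrdConnected
  nontrivial : J.Nontrivial
  smooth : ContMDiffOn 𝓘(ℝ, ℝ) 𝓘(ℝ, E) ∞ γ J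
  velocity_ne_zero : ∀ t ∈ J, ∀ q : M, γ t ∈ (extChartAt 𝓘(ℝ, E) q).source →
    derivWithin (fun s => extChartAt 𝓘(ℝ, E) q (γ s)) J t ≠ 0
  equation : ∀ t ∈ J, ∀ q : M, γ t ∈ (extChartAt 𝓘(ℝ, E) q).source →
    GeodesicEquation F q (extChartAt 𝓘(ℝ, E) q (γ t))
      (derivWithin (fun s => extChartAt 𝓘(ℝ, E) q (γ s)) J t)
      (derivWithin (derivWithin (fun s => extChartAt 𝓘(ℝ, E) q (γ s)) J) J t)

end Finsler

/-! ### Lie groups -/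

section LieGroups

variable {E : Type*} [NormedAddCommGroup E] [NormedSpace ℝ E]
  {G : Type*} [TopologicalSpace G] [ChartedSpace E G] [Group G]

/-- `c` is the one-parameter subgroup `t ↦ exp(tX)` of `G`: a smooth homomorphism from `(ℝ, +)`
to `G` with initial velocity `X`. -/
structure IsOneParameterSubgroup (X : GroupLieAlgebra 𝓘(ℝ, E) G) (c : ℝ → G) : Prop where
  map_zero : c 0 = 1
  map_add : ∀ s t, c (s + t) = c s * c t
  smooth : ContMDiff 𝓘(ℝ, ℝ) 𝓘(ℝ, E) ∞ c
  velocity : (mfderiv 𝓘(ℝ, ℝ) 𝓘(ℝ, E) c 0 (1 : ℝ) : E) = X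

/-- `X` is in the Lie algebra of the subgroup `H`: `exp(tX) ∈ H` for all `t`. -/
def MemLieAlgebra (H : Subgroup G) (X : GroupLieAlgebra 𝓘(ℝ, E) G) : Prop :=
  ∃ c : ℝ → G, IsOneParameterSubgroup X c ∧ ∀ t, c t ∈ H

/-- The adjoint action `Ad(a)` on the Lie algebra: the differential at `1` of the conjugation
`g ↦ a g a⁻¹`. -/
def Ad (a : G) (X : GroupLieAlgebra 𝓘(ℝ, E) G) : GroupLieAlgebra 𝓘(ℝ, E) G :=
  (mfderiv 𝓘(ℝ, E) 𝓘(ℝ, E) (fun g : G => a * g * a⁻¹) 1 X : E)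

end LieGroups

/-! ### Naturally reductive homogeneous Finsler spaces -/

section Homogeneous

variable {EG : Type*} [NormedAddCommGroup EG] [NormedSpace ℝ EG]
  {G : Type*} [TopologicalSpace G] [ChartedSpace EG G] [Group G]
  {E : Type*} [NormedAddCommGroup E] [NormedSpace ℝ E]

/-- The differential at the identity of the projection `π : G → G ⧸ H`, a linear map from the
Lie algebra of `G` to the tangent space of `G ⧸ H` at the origin. -/
def dproj (H : Subgroup G) [ChartedSpace E (G ⧸ H)] :
    GroupLieAlgebra 𝓘(ℝ, EG) G →L[ℝ] TangentSpace 𝓘(ℝ, E) (QuotientGroup.mk 1 : G ⧸ H) :=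
  mfderiv 𝓘(ℝ, EG) 𝓘(ℝ, E) (QuotientGroup.mk : G → G ⧸ H) 1

/-- The Minkowski norm of `F` at the origin of `G ⧸ H`, pulled back to the Lie algebra of `G`;
on a complement `m` of the Lie algebra of `H` this is the identification of `m` with the tangent
space at the origin. -/
def normAtOrigin (H : Subgroup G) [ChartedSpace E (G ⧸ H)]
    (F : TangentBundle 𝓘(ℝ, E) (G ⧸ H) → ℝ) : GroupLieAlgebra 𝓘(ℝ, EG) G → ℝ :=
  fun X => fiber F (QuotientGroup.mk 1 : G ⧸ H) (dproj H X)

/-- The Finsler metric `F` on `G ⧸ H` is `G`-invariant: `G` acts by isometries. -/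
def IsInvariant (H : Subgroup G) [ChartedSpace E (G ⧸ H)]
    (F : TangentBundle 𝓘(ℝ, E) (G ⧸ H) → ℝ) : Prop :=
  ∀ a : G, IsIsometricMap F (fun x : G ⧸ H => a • x)

variable (EG) in
/-- `(G ⧸ H, F)` is naturally reductive: there is an `Ad(H)`-invariant decomposition
`𝔤 = 𝔥 + 𝔪`, where `𝔥` is the Lie algebra of `H`, such that
`g_y([x, u]_𝔪, v) + g_y(u, [x, v]_𝔪) + 2 C_y([x, y]_𝔪, u, v) = 0`
for all `x, y, u, v ∈ 𝔪` with `y ≠ 0`. -/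
def IsNaturallyReductive (H : Subgroup G) [ChartedSpace E (G ⧸ H)]
    (F : TangentBundle 𝓘(ℝ, E) (G ⧸ H) → ℝ) : Prop :=
  ∃ (h m : Submodule ℝ (GroupLieAlgebra 𝓘(ℝ, EG) G)) (hm : IsCompl m h),
    (∀ X, X ∈ h ↔ MemLieAlgebra H X) ∧
    (∀ a ∈ H, ∀ X ∈ m, Ad a X ∈ m) ∧
    ∀ x ∈ m, ∀ y ∈ m, ∀ u ∈ m, ∀ v ∈ m, y ≠ 0 →
      fundamentalForm (normAtOrigin H F) y (m.projection h hm ⁅x, u⁆) v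
        + fundamentalForm (normAtOrigin H F) y u (m.projection h hm ⁅x, v⁆)
        + 2 * cartanForm (normAtOrigin H F) y (m.projection h hm ⁅x, y⁆) u v = 0

end Homogeneous

end FinslerHomogeneous

end

namespace FinslerHomogeneous

open Set Filter Topology

/-! ### Calculus of Minkowski norms: Euler's relations for `φ ^ 2`. -/

section MinkowskiCalculus

variable {V : Type*} [NormedAddCommGroup V] [NormedSpace ℝ V]

/-! Geodesics of constant speed are the extremals of the energy `F ^ 2`: by homogeneity the spray
equation is its Euler-Lagrange equation (`IsFinslerMetric.geodesicEquation_iff`). The energy is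
nondegenerate in the velocity, so a geodesic is determined by its position and velocity at one time
(`IsGeodesicOn.eqOn`). It therefore suffices to find, for each nonzero tangent vector, an orbit of a
one-parameter group that is a geodesic with this velocity.

Let `φ` be the norm at the origin pulled back to `𝔤` by `dπ`. In the natural reductivity identity
put `y = u = v = X`. The Cartan term vanishes because `g_y` does not change along the ray of `y`,
and what remains is `g_X([Z, X]_𝔪, X) = 0` for `Z ∈ 𝔪`, that is, `d(φ²)_X` vanishes on `[X, Z]`. The
component in `𝔥` plays no role, since `dπ` kills `𝔥`. For `Z ∈ 𝔥` the same vanishing is the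
infinitesimal form of the `Ad(H)`-invariance of `φ`. Thus `d(φ²)_X [X, Z] = 0` for all `Z ∈ 𝔤`
(`IsNaturallyReductive.fderiv_originNorm_bracket`).

This makes `a exp(sX) H` a geodesic, by an argument in the style of Noether
(`eulerLagrange_of_variation`, `IsOneParameterSubgroup.isGeodesicOn_orbit`). Vary the curve by `Ψ(r,
s) = a exp(sX) exp(rZ) H`. By invariance the energy of the varied velocity is `φ²(Ad(exp(-rZ)) X)`,
whose derivative at `r = 0` is `d(φ²)_X [X, Z] = 0`; the momentum in the direction of the variation
is the constant `d(φ²)_X Z`. Together these give the Euler-Lagrange equation in the direction of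
`Z`, and such directions fill the tangent space.

Finally, every tangent vector at `aH` comes from some `X ∈ 𝔪`, and `b exp(tX) H` is the orbit of
`bH` under the conjugate group `b exp(tX) b⁻¹`. -/

theorem fundamentalForm_eq_fderiv {φ : V → ℝ} {y : V}
    (h : ContDiffAt ℝ 2 (fun z => φ z ^ 2) y) (u v : V) :
    fundamentalForm φ y u v = 1 / 2 * fderiv ℝ (fderiv ℝ fun z => φ z ^ 2) y u v := by
  have hline : Tendsto (fun s : ℝ => y + s • u) (𝓝 0) (𝓝 y) := by
    have : Continuous fun s : ℝ => y + s • u := by fun_prop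
    simpa using this.tendsto 0
  have h1 : ∀ᶠ s : ℝ in 𝓝 0, deriv (fun t : ℝ => φ (y + s • u + t • v) ^ 2) 0
      = fderiv ℝ (fun z => φ z ^ 2) (y + s • u) v := by
    have := hline.eventually ((h.eventually (by simp)))
    filter_upwards [this] with s hs
    have hd : HasFDerivAt (fun z => φ z ^ 2) (fderiv ℝ (fun z => φ z ^ 2) (y + s • u))
        (y + s • u + (0 : ℝ) • v) := by
      rw [zero_smul, add_zero]
      exact (hs.differentiableAt (by simp)).hasFDerivAt
    have hl : HasDerivAt (fun t : ℝ => y + s • u + t • v) v 0 := by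
      simpa using ((hasDerivAt_id (0 : ℝ)).smul_const v).const_add (y + s • u)
    exact (hd.comp_hasDerivAt (0 : ℝ) hl).deriv
  have hd : HasFDerivAt (fderiv ℝ fun z => φ z ^ 2)
      (fderiv ℝ (fderiv ℝ fun z => φ z ^ 2) y) (y + (0 : ℝ) • u) := by
    rw [zero_smul, add_zero]
    exact ((h.fderiv_right (m := 1) (by norm_num)).differentiableAt (by simp)).hasFDerivAt
  have hl : HasDerivAt (fun t : ℝ => y + t • u) u 0 := by
    simpa using ((hasDerivAt_id (0 : ℝ)).smul_const u).const_add y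
  have h2 := (ContinuousLinearMap.apply ℝ ℝ v).hasFDerivAt.comp_hasDerivAt (0 : ℝ)
    (hd.comp_hasDerivAt (0 : ℝ) hl)
  have h3 : deriv (fun s : ℝ => deriv (fun t : ℝ => φ (y + s • u + t • v) ^ 2) 0) 0
      = fderiv ℝ (fderiv ℝ fun z => φ z ^ 2) y u v :=
    (Filter.EventuallyEq.deriv_eq h1).trans h2.deriv
  rw [fundamentalForm, h3]

theorem fundamentalForm_comm {φ : V → ℝ} {y : V}
    (h : ContDiffAt ℝ 2 (fun z => φ z ^ 2) y) (u v : V) :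
    fundamentalForm φ y u v = fundamentalForm φ y v u := by
  rw [fundamentalForm_eq_fderiv h, fundamentalForm_eq_fderiv h]
  congr 1
  exact (h.isSymmSndFDerivAt (by simp)) u v

/-- Differentiate `φ²(tz) = t² φ²(z)` in `z` and cancel one factor `t`. -/
theorem fderiv_sq_smul {φ : V → ℝ} (hom : ∀ (y : V) (t : ℝ), 0 ≤ t → φ (t • y) = t * φ y)
    (y : V) {t : ℝ} (ht : 0 < t) :
    fderiv ℝ (fun z => φ z ^ 2) (t • y) = t • fderiv ℝ (fun z => φ z ^ 2) y := by
  have h1 : (fun z => φ (t • z) ^ 2) = fun z => t ^ 2 • φ z ^ 2 := by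
    ext z
    rw [hom z t ht.le, mul_pow, smul_eq_mul]
  have h2 := fderiv_comp_smul (𝕜 := ℝ) (f := fun z => φ z ^ 2) (x := y) t
  have h3 : fderiv ℝ (fun z => t ^ 2 • φ z ^ 2) y = t ^ 2 • fderiv ℝ (fun z => φ z ^ 2) y :=
    congrFun (fderiv_const_smul_field (f := fun z => φ z ^ 2) (t ^ 2)) y
  rw [h1, h3] at h2
  have ht' : t ≠ 0 := ht.ne'
  calc _ = t⁻¹ • (t • fderiv ℝ (fun z => φ z ^ 2) (t • y)) := by rw [inv_smul_smul₀ ht']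
    _ = _ := by rw [← h2, smul_smul]; congr 1; field_simp

/-- Euler's relation for the differential of `φ²`, which is homogeneous of degree one. The ray is
differentiated at `t = 1`, because `φ²` need not be twice differentiable at the origin. -/
theorem fderiv_fderiv_sq_self {φ : V → ℝ}
    (hom : ∀ (y : V) (t : ℝ), 0 ≤ t → φ (t • y) = t * φ y) {y : V}
    (h : ContDiffAt ℝ 2 (fun z => φ z ^ 2) y) :
    fderiv ℝ (fderiv ℝ fun z => φ z ^ 2) y y = fderiv ℝ (fun z => φ z ^ 2) y := by
  have hd : HasFDerivAt (fderiv ℝ fun z => φ z ^ 2)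
      (fderiv ℝ (fderiv ℝ fun z => φ z ^ 2) y) ((1 : ℝ) • y) := by
    rw [one_smul]
    exact ((h.fderiv_right (m := 1) (by norm_num)).differentiableAt (by simp)).hasFDerivAt
  have hl : HasDerivAt (fun t : ℝ => t • y) y 1 := by
    simpa using (hasDerivAt_id (1 : ℝ)).smul_const y
  have h1 := (hd.comp_hasDerivAt (1 : ℝ) hl)
  have h2 : HasDerivAt (fun t : ℝ => t • fderiv ℝ (fun z => φ z ^ 2) y)
      (fderiv ℝ (fun z => φ z ^ 2) y) 1 := by
    simpa using (hasDerivAt_id (1 : ℝ)).smul_const (fderiv ℝ (fun z => φ z ^ 2) y)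
  refine (h1.congr_of_eventuallyEq ?_).unique h2
  filter_upwards [lt_mem_nhds (zero_lt_one : (0 : ℝ) < 1)] with t ht
  exact (fderiv_sq_smul hom y ht).symm

theorem fundamentalForm_self_left {φ : V → ℝ}
    (hom : ∀ (y : V) (t : ℝ), 0 ≤ t → φ (t • y) = t * φ y) {y : V}
    (h : ContDiffAt ℝ 2 (fun z => φ z ^ 2) y) (w : V) :
    fundamentalForm φ y y w = 1 / 2 * fderiv ℝ (fun z => φ z ^ 2) y w := by
  rw [fundamentalForm_eq_fderiv h, fderiv_fderiv_sq_self hom h]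

theorem fderiv_sq_self {φ : V → ℝ}
    (hom : ∀ (y : V) (t : ℝ), 0 ≤ t → φ (t • y) = t * φ y) {y : V}
    (h : DifferentiableAt ℝ (fun z => φ z ^ 2) y) :
    fderiv ℝ (fun z => φ z ^ 2) y y = 2 * φ y ^ 2 := by
  have hd : HasFDerivAt (fun z => φ z ^ 2) (fderiv ℝ (fun z => φ z ^ 2) y) ((1 : ℝ) • y) := by
    rw [one_smul]
    exact h.hasFDerivAt
  have hl : HasDerivAt (fun t : ℝ => t • y) y 1 := by
    simpa using (hasDerivAt_id (1 : ℝ)).smul_const y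
  have h1 := (hd.comp_hasDerivAt (1 : ℝ) hl)
  have h2 : HasDerivAt (fun t : ℝ => t ^ 2 * φ y ^ 2) (2 * φ y ^ 2) 1 := by
    simpa using (hasDerivAt_pow 2 (1 : ℝ)).mul_const (φ y ^ 2)
  refine (h1.congr_of_eventuallyEq ?_).unique h2
  filter_upwards [lt_mem_nhds (zero_lt_one : (0 : ℝ) < 1)] with t ht
  simp only [Function.comp_apply]
  rw [hom y t (le_of_lt ht), mul_pow]

/-- Rescaling both parameters by `t⁻¹` cancels the factor `t²` of `φ²`. The scaling rules for
`deriv` hold without differentiability, so none is assumed. -/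
theorem fundamentalForm_smul {φ : V → ℝ}
    (hom : ∀ (y : V) (t : ℝ), 0 ≤ t → φ (t • y) = t * φ y) (y : V) {t : ℝ} (ht : 0 < t)
    (u v : V) : fundamentalForm φ (t • y) u v = fundamentalForm φ y u v := by
  have ht' : t ≠ 0 := ht.ne'
  have h1 : ∀ s r : ℝ, φ (t • y + s • u + r • v) ^ 2
      = t ^ 2 * φ (y + (t⁻¹ * s) • u + (t⁻¹ * r) • v) ^ 2 := by
    intro s r
    rw [← mul_pow, ← hom _ t ht.le, smul_add, smul_add, smul_smul, smul_smul,
      mul_inv_cancel_left₀ ht', mul_inv_cancel_left₀ ht']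
  unfold fundamentalForm
  congr 1
  simp_rw [h1]
  have h2 : ∀ s : ℝ, deriv (fun r : ℝ => t ^ 2 * φ (y + (t⁻¹ * s) • u + (t⁻¹ * r) • v) ^ 2) 0
      = t * deriv (fun r : ℝ => φ (y + (t⁻¹ * s) • u + r • v) ^ 2) 0 := by
    intro s
    rw [deriv_const_mul_field,
      deriv_comp_mul_left t⁻¹ (fun r : ℝ => φ (y + (t⁻¹ * s) • u + r • v) ^ 2), mul_zero,
      smul_eq_mul]
    field_simp
  simp_rw [h2]
  rw [deriv_const_mul_field, deriv_comp_mul_left t⁻¹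
    (fun s : ℝ => deriv (fun r : ℝ => φ (y + s • u + r • v) ^ 2) 0), mul_zero, smul_eq_mul]
  field_simp

theorem cartanForm_self_right {φ : V → ℝ}
    (hom : ∀ (y : V) (t : ℝ), 0 ≤ t → φ (t • y) = t * φ y) (y u v : V) :
    cartanForm φ y u v y = 0 := by
  unfold cartanForm
  have : (fun t : ℝ => fundamentalForm φ (y + t • y) u v)
      =ᶠ[𝓝 0] fun _ => fundamentalForm φ y u v := by
    filter_upwards [lt_mem_nhds (show (-1 : ℝ) < 0 by norm_num)] with t ht
    have : y + t • y = (1 + t) • y := by rw [add_smul, one_smul]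
    rw [this, fundamentalForm_smul hom y (by linarith)]
  rw [this.deriv_eq]
  simp

end MinkowskiCalculus

theorem two_le_infty : (1 : WithTop ℕ∞) + 1 ≤ ∞ := by
  rw [one_add_one_eq_two]
  exact WithTop.coe_le_coe.2 le_top

/-! ### The metric in charts, and the geodesic equation as an Euler-Lagrange equation. -/

section Coordinates

variable {E : Type*} [NormedAddCommGroup E] [NormedSpace ℝ E]
  {M : Type*} [TopologicalSpace M] [ChartedSpace E M] [IsManifold 𝓘(ℝ, E) ∞ M]

theorem isInvertible_mfderiv_extChartAt_symm {q : M} {x : E}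
    (hx : x ∈ (extChartAt 𝓘(ℝ, E) q).target) :
    (mfderiv 𝓘(ℝ, E) 𝓘(ℝ, E) (extChartAt 𝓘(ℝ, E) q).symm x).IsInvertible := by
  have : IsManifold 𝓘(ℝ, E) 1 M := IsManifold.of_le (n := ∞) (by simp)
  have := isInvertible_mfderivWithin_extChartAt_symm (I := 𝓘(ℝ, E)) hx
  rwa [modelWithCornersSelf_coe, range_id, mfderivWithin_univ] at this

theorem contMDiffOn_tangentMap_extChartAt_symm (q : M) :
    ContMDiffOn (𝓘(ℝ, E).tangent) (𝓘(ℝ, E).tangent) ∞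
      (tangentMap 𝓘(ℝ, E) 𝓘(ℝ, E) (extChartAt 𝓘(ℝ, E) q).symm)
      {p : TangentBundle 𝓘(ℝ, E) E | p.1 ∈ (extChartAt 𝓘(ℝ, E) q).target} := by
  have hopen : IsOpen (extChartAt 𝓘(ℝ, E) q).target := isOpen_extChartAt_target q
  have : IsManifold 𝓘(ℝ, E) 1 M := IsManifold.of_le (n := ∞) (by simp)
  have h := (contMDiffOn_extChartAt_symm (I := 𝓘(ℝ, E)) (n := ∞) q).contMDiffOn_tangentMapWithin
    (m := ∞) (by simp) hopen.uniqueMDiffOn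
  refine h.congr fun p hp => ?_
  refine (tangentMapWithin_eq_tangentMap (hopen.uniqueMDiffOn _ hp) ?_).symm
  exact ((contMDiffOn_extChartAt_symm (I := 𝓘(ℝ, E)) (n := ∞) q).contMDiffAt
    (hopen.mem_nhds hp)).mdifferentiableAt (by simp)

variable {F : TangentBundle 𝓘(ℝ, E) M → ℝ}

theorem IsFinslerMetric.contDiffAt_localF (hF : IsFinslerMetric F) {q : M} {x y : E}
    (hx : x ∈ (extChartAt 𝓘(ℝ, E) q).target) (hy : y ≠ 0) :
    ContDiffAt ℝ ∞ (fun z : E × E => localF F q z.1 z.2) (x, y) := by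
  have hopen : IsOpen (extChartAt 𝓘(ℝ, E) q).target := isOpen_extChartAt_target q
  set S : Set (E × E) := (extChartAt 𝓘(ℝ, E) q).target ×ˢ {0}ᶜ with hS
  have hSo : IsOpen S := hopen.prod isOpen_compl_singleton
  have h1 : ContMDiff 𝓘(ℝ, E × E) (𝓘(ℝ, E).tangent) ∞
      (fun z : E × E => (⟨z.1, z.2⟩ : TangentBundle 𝓘(ℝ, E) E)) := by
    have := contMDiff_tangentBundleModelSpaceHomeomorph_symm (I := 𝓘(ℝ, E)) (n := ∞)
    rw [modelWithCornersSelf_prod]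
    exact this
  have h2 := (contMDiffOn_tangentMap_extChartAt_symm q).comp (h1.contMDiffOn (s := S))
    (fun z hz => hz.1)
  have h3 := hF.smooth.comp h2 ?_
  · exact (h3.contMDiffAt (hSo.mem_nhds (mk_mem_prod hx hy))).contDiffAt
  -- The differential of the inverse chart is injective, so nonzero coordinate velocities stay off
  -- the zero section.
  · intro z hz h0
    refine hz.2 ?_
    have hinv := (isInvertible_mfderiv_extChartAt_symm hz.1).injective
    exact hinv (h0.trans (map_zero _).symm)

theorem IsFinslerMetric.localF_smul (hF : IsFinslerMetric F) (q : M) (x y : E) {t : ℝ}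
    (ht : 0 ≤ t) : localF F q x (t • y) = t * localF F q x y := by
  set A := mfderiv 𝓘(ℝ, E) 𝓘(ℝ, E) (extChartAt 𝓘(ℝ, E) q).symm x with hA
  change F ⟨_, A (t • y)⟩ = t * F ⟨_, A y⟩
  rw [← hF.homogeneous _ (A y) t ht]
  congr 2
  exact map_smul A t y

theorem IsFinslerMetric.localG_pos (hF : IsFinslerMetric F) {q : M} {x y u : E}
    (hx : x ∈ (extChartAt 𝓘(ℝ, E) q).target) (hy : y ≠ 0) (hu : u ≠ 0) :
    0 < localG F q x y u u := by
  set A := mfderiv 𝓘(ℝ, E) 𝓘(ℝ, E) (extChartAt 𝓘(ℝ, E) q).symm x with hA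
  have hinv : Function.Injective A := (isInvertible_mfderiv_extChartAt_symm hx).injective
  have h := hF.posDef ((extChartAt 𝓘(ℝ, E) q).symm x) (A y) (A u)
    (fun h => hy (hinv (h.trans (map_zero A).symm)))
    (fun h => hu (hinv (h.trans (map_zero A).symm)))
  convert h using 1
  simp only [localG, fundamentalForm]
  have key : ∀ s t : ℝ, localF F q x (y + s • u + t • u)
      = fiber F ((extChartAt 𝓘(ℝ, E) q).symm x) (A y + s • A u + t • A u) := by
    intro s t
    change F ⟨_, A (y + s • u + t • u)⟩ = F ⟨_, A y + s • A u + t • A u⟩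
    congr 2
    exact (map_add A _ _).trans (congrArg₂ _ ((map_add A _ _).trans
      (congrArg _ (map_smul A s u))) (map_smul A t u))
  simp_rw [key]

/-- The square of the Finsler metric in the natural coordinates of `TM`. -/
noncomputable def energy (F : TangentBundle 𝓘(ℝ, E) M → ℝ) (q : M) (z : E × E) : ℝ :=
  localF F q z.1 z.2 ^ 2

theorem IsFinslerMetric.contDiffAt_energy (hF : IsFinslerMetric F) {q : M} {x y : E}
    (hx : x ∈ (extChartAt 𝓘(ℝ, E) q).target) (hy : y ≠ 0) :
    ContDiffAt ℝ ∞ (energy F q) (x, y) :=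
  (hF.contDiffAt_localF hx hy).pow 2

theorem IsFinslerMetric.contDiffAt_localF_sq (hF : IsFinslerMetric F) {q : M} {x y : E}
    (hx : x ∈ (extChartAt 𝓘(ℝ, E) q).target) (hy : y ≠ 0) :
    ContDiffAt ℝ ∞ (fun y => localF F q x y ^ 2) y :=
  (hF.contDiffAt_energy hx hy).comp (f := fun y => (x, y)) y (by fun_prop)

theorem IsFinslerMetric.fderiv_localF_sq (hF : IsFinslerMetric F) {q : M} {x y : E}
    (hx : x ∈ (extChartAt 𝓘(ℝ, E) q).target) (hy : y ≠ 0) (w : E) :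
    fderiv ℝ (fun y => localF F q x y ^ 2) y w = fderiv ℝ (energy F q) (x, y) (0, w) := by
  have h1 := ((hF.contDiffAt_energy hx hy).differentiableAt (by simp)).hasFDerivAt
  have h2 : HasFDerivAt (fun y : E => (x, y)) (ContinuousLinearMap.inr ℝ E E) y :=
    hasFDerivAt_prodMk_right x y
  have h3 := (h1.comp y h2).fderiv
  change fderiv ℝ (energy F q ∘ fun y => (x, y)) y w = _
  rw [h3]
  rfl

theorem IsFinslerMetric.localG_eq (hF : IsFinslerMetric F) {q : M} {x y : E}
    (hx : x ∈ (extChartAt 𝓘(ℝ, E) q).target) (hy : y ≠ 0) (u w : E) :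
    localG F q x y u w = 1 / 2 * fderiv ℝ (fderiv ℝ (energy F q)) (x, y) (0, u) (0, w) := by
  rw [localG, fundamentalForm_eq_fderiv (
    (hF.contDiffAt_localF_sq hx hy).of_le (one_add_one_eq_two (R := WithTop ℕ∞) ▸ two_le_infty))]
  congr 1
  have hsm := hF.contDiffAt_energy hx hy
  have h1 := ((hsm.fderiv_right (m := 1) two_le_infty).differentiableAt
    (by simp)).hasFDerivAt
  have h2 : HasFDerivAt (fun y : E => (x, y)) (ContinuousLinearMap.inr ℝ E E) y :=
    hasFDerivAt_prodMk_right x y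
  have h3 := (ContinuousLinearMap.apply ℝ ℝ ((0, w) : E × E)).hasFDerivAt.comp y (h1.comp y h2)
  have h4 := (((hF.contDiffAt_localF_sq hx hy).fderiv_right (m := 1)
    two_le_infty).differentiableAt (by simp)).hasFDerivAt
  have h5 := (ContinuousLinearMap.apply ℝ ℝ w).hasFDerivAt.comp y h4
  have h6 := h5.congr_of_eventuallyEq
    (f₁ := ⇑(ContinuousLinearMap.apply ℝ ℝ ((0, w) : E × E)) ∘ fderiv ℝ (energy F q) ∘
      fun y => (x, y)) (by
      filter_upwards [isOpen_ne.mem_nhds hy] with y' hy'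
      exact (hF.fderiv_localF_sq hx hy' w).symm)
  exact (congrArg (fun L : E →L[ℝ] ℝ => L u) (h6.unique h3))

theorem IsFinslerMetric.localG_self_left (hF : IsFinslerMetric F) {q : M} {x y : E}
    (hx : x ∈ (extChartAt 𝓘(ℝ, E) q).target) (hy : y ≠ 0) (w : E) :
    localG F q x y y w = 1 / 2 * fderiv ℝ (energy F q) (x, y) (0, w) := by
  rw [localG, fundamentalForm_self_left (fun y t ht => hF.localF_smul q x y ht)
    (
    (hF.contDiffAt_localF_sq hx hy).of_le (one_add_one_eq_two (R := WithTop ℕ∞) ▸ two_le_infty)),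
    hF.fderiv_localF_sq hx hy]

theorem IsFinslerMetric.localG_self (hF : IsFinslerMetric F) {q : M} {x y : E}
    (hx : x ∈ (extChartAt 𝓘(ℝ, E) q).target) (hy : y ≠ 0) :
    localG F q x y y y = energy F q (x, y) := by
  rw [localG, fundamentalForm_self_left (fun y t ht => hF.localF_smul q x y ht)
    (
    (hF.contDiffAt_localF_sq hx hy).of_le (one_add_one_eq_two (R := WithTop ℕ∞) ▸ two_le_infty)),
    fderiv_sq_self (fun y t ht => hF.localF_smul q x y ht)
    ((hF.contDiffAt_localF_sq hx hy).differentiableAt (by simp)), energy]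
  ring

/-- The geodesic equation is the Euler-Lagrange equation of the energy. -/
theorem IsFinslerMetric.geodesicEquation_iff (hF : IsFinslerMetric F) {q : M} {x y : E}
    (hx : x ∈ (extChartAt 𝓘(ℝ, E) q).target) (hy : y ≠ 0) (a : E) :
    GeodesicEquation F q x y a ↔ ∀ w : E,
      fderiv ℝ (fderiv ℝ (energy F q)) (x, y) (y, a) (0, w)
        = fderiv ℝ (energy F q) (x, y) (w, 0) := by
  have hopen : IsOpen (extChartAt 𝓘(ℝ, E) q).target := isOpen_extChartAt_target q
  have hsm := hF.contDiffAt_energy hx hy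
  have h1 := ((hsm.fderiv_right (m := 1) two_le_infty).differentiableAt
    (by simp)).hasFDerivAt
  have h2 : HasFDerivAt (fun x : E => (x, y)) (ContinuousLinearMap.inl ℝ E E) x :=
    hasFDerivAt_prodMk_left x y
  refine forall_congr' fun w => ?_
  -- Contracted once with `y`, the fundamental tensor is half the velocity derivative of the energy;
  -- contracted twice, it is the energy itself. The position derivatives of `g` thus become a mixed
  -- second derivative and a first derivative of the energy.
  have e1 : fderiv ℝ (fun x' : E => localG F q x' y y w) x y
      = 1 / 2 * fderiv ℝ (fderiv ℝ (energy F q)) (x, y) (y, 0) (0, w) := by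
    have h3 := ((ContinuousLinearMap.apply ℝ ℝ ((0, w) : E × E)).hasFDerivAt.comp x
      (h1.comp x h2)).const_mul (1 / 2 : ℝ)
    have h4 := h3.congr_of_eventuallyEq (f₁ := fun x' : E => localG F q x' y y w) (by
      filter_upwards [hopen.mem_nhds hx] with x' hx'
      exact hF.localG_self_left hx' hy w)
    rw [h4.fderiv]
    rfl
  have e2 : fderiv ℝ (fun x' : E => localG F q x' y y y) x w
      = fderiv ℝ (energy F q) (x, y) (w, 0) := by
    have h3 := ((hsm.differentiableAt (by simp)).hasFDerivAt).comp x h2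
    have h4 := h3.congr_of_eventuallyEq (f₁ := fun x' : E => localG F q x' y y y) (by
      filter_upwards [hopen.mem_nhds hx] with x' hx'
      exact hF.localG_self hx' hy)
    rw [h4.fderiv]
    rfl
  have e3 : ((y, a) : E × E) = (y, 0) + (0, a) := by simp
  rw [e1, e2, hF.localG_eq hx hy, e3, map_add, add_apply]
  constructor <;> intro h <;> linarith

end Coordinates

/-! ### Uniqueness for ODEs on arbitrary intervals, and the spray of a nondegenerate Lagrangian. -/

section Uniqueness

variable {E : Type*} [NormedAddCommGroup E] [NormedSpace ℝ E]

/-- Solutions on a (not necessarily open) interval of an ODE with Lipschitz right-hand side are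
determined by their value at one point. -/
theorem eqOn_of_hasDerivWithinAt {v : E → E} {U : Set E} {K : NNReal}
    (hv : LipschitzOnWith K v U) {J : Set ℝ} (hJ : J.OrdConnected) {f g : ℝ → E}
    (hf : ∀ t ∈ J, HasDerivWithinAt f (v (f t)) J t) (hfU : ∀ t ∈ J, f t ∈ U)
    (hg : ∀ t ∈ J, HasDerivWithinAt g (v (g t)) J t) (hgU : ∀ t ∈ J, g t ∈ U)
    {t₀ : ℝ} (ht₀ : t₀ ∈ J) (h : f t₀ = g t₀) : EqOn f g J := by
  intro t ht
  -- Endpoints of `J` are harmless: forward in time only right derivatives matter, backward only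
  -- left ones, and `J` is a one-sided neighbourhood in either case.
  have hright : ∀ {a b : ℝ}, Icc a b ⊆ J → ∀ s ∈ Ico a b, J ∈ 𝓝[≥] s := by
    intro a b hab s hs
    filter_upwards [Ico_mem_nhdsGE hs.2] with r hr
    exact hab ⟨hs.1.trans hr.1, hr.2.le⟩
  have hleft : ∀ {a b : ℝ}, Icc a b ⊆ J → ∀ s ∈ Ioc a b, J ∈ 𝓝[≤] s := by
    intro a b hab s hs
    filter_upwards [Ioc_mem_nhdsLE hs.1] with r hr
    exact hab ⟨hr.1.le, hr.2.trans hs.2⟩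
  rcases le_total t₀ t with hle | hle
  · have hsub : Icc t₀ t ⊆ J := hJ.out ht₀ ht
    have hmem : ∀ s ∈ Ico t₀ t, s ∈ J := fun s hs => hsub (Ico_subset_Icc_self hs)
    exact ODE_solution_unique_of_mem_Icc_right (v := fun _ => v) (s := fun _ => U)
      (fun _ _ => hv) (fun s hs => ((hf s (hsub hs)).continuousWithinAt).mono hsub)
      (fun s hs => (hf s (hmem s hs)).mono_of_mem_nhdsWithin (hright hsub s hs))
      (fun s hs => hfU s (hmem s hs))
      (fun s hs => ((hg s (hsub hs)).continuousWithinAt).mono hsub)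
      (fun s hs => (hg s (hmem s hs)).mono_of_mem_nhdsWithin (hright hsub s hs))
      (fun s hs => hgU s (hmem s hs)) h ⟨hle, le_rfl⟩
  · have hsub : Icc t t₀ ⊆ J := hJ.out ht ht₀
    have hmem : ∀ s ∈ Ioc t t₀, s ∈ J := fun s hs => hsub (Ioc_subset_Icc_self hs)
    exact ODE_solution_unique_of_mem_Icc_left (v := fun _ => v) (s := fun _ => U)
      (fun _ _ => hv) (fun s hs => ((hf s (hsub hs)).continuousWithinAt).mono hsub)
      (fun s hs => (hf s (hmem s hs)).mono_of_mem_nhdsWithin (hleft hsub s hs))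
      (fun s hs => hfU s (hmem s hs))
      (fun s hs => ((hg s (hsub hs)).continuousWithinAt).mono hsub)
      (fun s hs => (hg s (hmem s hs)).mono_of_mem_nhdsWithin (hleft hsub s hs))
      (fun s hs => hgU s (hmem s hs)) h ⟨le_rfl, hle⟩

variable [FiniteDimensional ℝ E]

/-- A Lagrangian that is nondegenerate in the velocities has a spray: locally, the acceleration in
the Euler-Lagrange equation is a Lipschitz function of position and velocity. -/
theorem exists_lipschitz_acceleration {L : E × E → ℝ} {z₀ : E × E} (hL : ContDiffAt ℝ ∞ L z₀)
    (hpos : ∀ u : E, u ≠ 0 → 0 < fderiv ℝ (fderiv ℝ L) z₀ (0, u) (0, u)) :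
    ∃ (S : E × E → E) (K : NNReal), ∃ U ∈ 𝓝 z₀, LipschitzOnWith K S U ∧
      ∀ z ∈ U, ∀ a : E,
        (∀ w : E, fderiv ℝ (fderiv ℝ L) z (z.2, a) (0, w) = fderiv ℝ L z (w, 0)) → a = S z := by
  set D := fderiv ℝ L with hD
  set D2 := fderiv ℝ D with hD2
  have hDs : ContDiffAt ℝ ∞ D z₀ := hL.fderiv_right (by simp)
  have hD2s : ContDiffAt ℝ ∞ D2 z₀ := hDs.fderiv_right (by simp)
  set R : ((E × E) →L[ℝ] ℝ) →L[ℝ] (E →L[ℝ] ℝ) :=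
    (ContinuousLinearMap.compL ℝ E (E × E) ℝ).flip (ContinuousLinearMap.inr ℝ E E) with hR
  set R' : ((E × E) →L[ℝ] ℝ) →L[ℝ] (E →L[ℝ] ℝ) :=
    (ContinuousLinearMap.compL ℝ E (E × E) ℝ).flip (ContinuousLinearMap.inl ℝ E E) with hR'
  -- `B` is the Hessian of `L` in the velocities, as a map from `E` to its dual, and `b` collects
  -- the terms without acceleration. The Euler-Lagrange equation reads `B a = b`, so the spray is `S
  -- = B⁻¹ b`.
  set B : E × E → (E →L[ℝ] (E →L[ℝ] ℝ)) :=
    fun z => R ∘L (D2 z ∘L ContinuousLinearMap.inr ℝ E E) with hB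
  set b : E × E → (E →L[ℝ] ℝ) := fun z => R' (D z) - R (D2 z (z.2, 0)) with hb
  have hBs : ContDiffAt ℝ ∞ B z₀ :=
    contDiffAt_const.clm_comp (hD2s.clm_comp contDiffAt_const)
  have hbs : ContDiffAt ℝ ∞ b z₀ := by
    refine (contDiffAt_const.clm_apply hDs).sub (contDiffAt_const.clm_apply (hD2s.clm_apply ?_))
    exact contDiffAt_snd.prodMk contDiffAt_const
  -- Positive definiteness gives injectivity, hence invertibility by equality of dimensions.
  -- Inversion is smooth and invertibility is an open condition, so `B⁻¹ b` is smooth at `z₀`, hence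
  -- locally Lipschitz.
  have hinj : Function.Injective (B z₀) := by
    rw [injective_iff_map_eq_zero]
    intro u hu
    by_contra hne
    have h1 : B z₀ u u = 0 := by rw [hu]; rfl
    exact (hpos u hne).ne' h1
  have hrank : Module.finrank ℝ E = Module.finrank ℝ (E →L[ℝ] ℝ) := by
    rw [← LinearMap.toContinuousLinearMap.finrank_eq (M := E →ₗ[ℝ] ℝ)]
    exact (Subspace.dual_finrank_eq (K := ℝ) (V := E)).symm
  let e : E ≃L[ℝ] (E →L[ℝ] ℝ) :=
    (LinearEquiv.ofInjectiveOfFinrankEq (B z₀ : E →ₗ[ℝ] (E →L[ℝ] ℝ)) hinj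
      hrank).toContinuousLinearEquiv
  have he : (e : E →L[ℝ] (E →L[ℝ] ℝ)) = B z₀ := by
    ext u w
    rfl
  have hinv : ContDiffAt ℝ ∞ (fun z => ContinuousLinearMap.inverse (B z)) z₀ := by
    have h1 : ContDiffAt ℝ ∞ ContinuousLinearMap.inverse (B z₀) := he ▸ contDiffAt_map_inverse e
    exact h1.comp z₀ hBs
  have hS : ContDiffAt ℝ 1 (fun z => ContinuousLinearMap.inverse (B z) (b z)) z₀ :=
    (hinv.clm_apply hbs).of_le (by exact_mod_cast le_top)
  obtain ⟨K, U, hU, hlip⟩ := hS.exists_lipschitzOnWith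
  have hnear : ∀ᶠ z in 𝓝 z₀, (B z).IsInvertible := by
    refine hBs.continuousAt.eventually ?_
    rw [← he]
    filter_upwards [ContinuousLinearEquiv.nhds e] with A hA
    exact hA
  refine ⟨_, K, U ∩ {z | (B z).IsInvertible}, inter_mem hU hnear,
    hlip.mono inter_subset_left, fun z hz a ha => ?_⟩
  have h1 : B z a = b z := by
    ext w
    have := ha w
    have e3 : ((z.2, a) : E × E) = (z.2, 0) + (0, a) := by simp
    rw [e3, map_add, add_apply] at this
    exact eq_sub_of_add_eq' this
  rw [← h1, hz.2.inverse_apply_eq.2 rfl]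

end Uniqueness

/-! ### A geodesic is determined by its position and velocity at one time. -/

section Geodesics

variable {E : Type*} [NormedAddCommGroup E] [NormedSpace ℝ E]
  {M : Type*} [TopologicalSpace M] [ChartedSpace E M]
  {F : TangentBundle 𝓘(ℝ, E) M → ℝ} {J : Set ℝ} {γ δ : ℝ → M}

theorem IsGeodesicOn.uniqueDiffOn (h : IsGeodesicOn F J γ) : UniqueDiffOn ℝ J := by
  obtain ⟨a, ha, b, hb, hab⟩ := h.nontrivial.exists_lt
  refine uniqueDiffOn_convex h.ordConnected.convex ⟨(a + b) / 2, ?_⟩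
  refine mem_interior.2 ⟨Ioo a b, fun t ht => ?_, isOpen_Ioo, by constructor <;> linarith⟩
  exact h.ordConnected.out ha hb (Ioo_subset_Icc_self ht)

variable [IsManifold 𝓘(ℝ, E) ∞ M]

theorem IsGeodesicOn.contDiffWithinAt_chart (h : IsGeodesicOn F J γ) {t : ℝ} (ht : t ∈ J) {q : M}
    (hq : γ t ∈ (extChartAt 𝓘(ℝ, E) q).source) :
    ContDiffWithinAt ℝ ∞ (fun s => extChartAt 𝓘(ℝ, E) q (γ s)) J t := by
  have h1 : ContMDiffAt 𝓘(ℝ, E) 𝓘(ℝ, E) ∞ (extChartAt 𝓘(ℝ, E) q) (γ t) :=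
    contMDiffAt_extChartAt' (by rwa [extChartAt_source] at hq)
  exact (h1.comp_contMDiffWithinAt t (h.smooth t ht)).contDiffWithinAt

theorem IsGeodesicOn.contDiffWithinAt_derivWithin (h : IsGeodesicOn F J γ) {t : ℝ} (ht : t ∈ J)
    {q : M} (hq : γ t ∈ (extChartAt 𝓘(ℝ, E) q).source) :
    ContDiffWithinAt ℝ ∞ (derivWithin (fun s => extChartAt 𝓘(ℝ, E) q (γ s)) J) J t := by
  have h1 := (h.contDiffWithinAt_chart ht hq).fderivWithin_right (m := ∞) h.uniqueDiffOn
    (by simp) ht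
  exact h1.clm_apply (contDiffWithinAt_const (c := (1 : ℝ)))

theorem IsGeodesicOn.eventually_eq [FiniteDimensional ℝ E] (hF : IsFinslerMetric F)
    (hγ : IsGeodesicOn F J γ) (hδ : IsGeodesicOn F J δ) {t : ℝ} (ht : t ∈ J) {q : M}
    (hq : γ t ∈ (extChartAt 𝓘(ℝ, E) q).source) (heq : γ t = δ t)
    (hvel : derivWithin (fun s => extChartAt 𝓘(ℝ, E) q (γ s)) J t
      = derivWithin (fun s => extChartAt 𝓘(ℝ, E) q (δ s)) J t) :
    ∃ ε > 0, EqOn γ δ (J ∩ Metric.ball t ε) := by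
  set z : (ℝ → M) → ℝ → E × E := fun γ s => (extChartAt 𝓘(ℝ, E) q (γ s),
    derivWithin (fun s => extChartAt 𝓘(ℝ, E) q (γ s)) J s) with hz
  have hq' : δ t ∈ (extChartAt 𝓘(ℝ, E) q).source := heq ▸ hq
  have hz0 : z γ t = z δ t := Prod.ext (congrArg (extChartAt 𝓘(ℝ, E) q) heq) hvel
  have hv0 := hγ.velocity_ne_zero t ht q hq
  have hx0 : extChartAt 𝓘(ℝ, E) q (γ t) ∈ (extChartAt 𝓘(ℝ, E) q).target :=
    (extChartAt 𝓘(ℝ, E) q).map_source hq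
  obtain ⟨S, K, U, hU, hlip, hS⟩ := exists_lipschitz_acceleration (L := energy F q)
    (z₀ := z γ t) (hF.contDiffAt_energy hx0 hv0) (fun u hu => by
      have := hF.localG_pos hx0 hv0 hu
      rw [hF.localG_eq hx0 hv0] at this
      change 0 < fderiv ℝ (fderiv ℝ (energy F q)) (_, _) _ _
      linarith)
  -- Near `t`, position and velocity together solve the first-order system `(x, y)' = (y, S(x, y))`,
  -- which has a Lipschitz right-hand side on `U`.
  have hsys : ∀ η : ℝ → M, IsGeodesicOn F J η → η t ∈ (extChartAt 𝓘(ℝ, E) q).source →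
      z η t = z γ t → ∀ᶠ s in 𝓝[J] t, η s ∈ (extChartAt 𝓘(ℝ, E) q).source ∧ z η s ∈ U ∧
        HasDerivWithinAt (z η) ((z η s).2, S (z η s)) J s := by
    intro η hη hηq hηz
    have hc : ContinuousWithinAt (z η) J t :=
        (hη.contDiffWithinAt_chart ht hηq).continuousWithinAt.prodMk
      (hη.contDiffWithinAt_derivWithin ht hηq).continuousWithinAt
    have h1 : ∀ᶠ s in 𝓝[J] t, η s ∈ (extChartAt 𝓘(ℝ, E) q).source :=
      (hη.smooth t ht).continuousWithinAt.eventually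
        ((isOpen_extChartAt_source q).mem_nhds hηq)
    have h2 : ∀ᶠ s in 𝓝[J] t, z η s ∈ U := hc.eventually (by rw [hηz]; exact hU)
    filter_upwards [h1, h2, self_mem_nhdsWithin] with s hs1 hs2 hsJ
    refine ⟨hs1, hs2, ?_⟩
    have hd1 := ((hη.contDiffWithinAt_chart hsJ hs1).differentiableWithinAt
      (by simp)).hasDerivWithinAt
    have hd2 := ((hη.contDiffWithinAt_derivWithin hsJ hs1).differentiableWithinAt
      (by simp)).hasDerivWithinAt
    have hEL := (hF.geodesicEquation_iff ((extChartAt 𝓘(ℝ, E) q).map_source hs1)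
      (hη.velocity_ne_zero s hsJ q hs1) _).1 (hη.equation s hsJ q hs1)
    rw [← hS _ hs2 _ hEL]
    exact hd1.prodMk hd2
  obtain ⟨ε, hε, hball⟩ := Metric.mem_nhdsWithin_iff.1
    ((hsys γ hγ hq rfl).and (hsys δ hδ hq' hz0.symm))
  refine ⟨ε, hε, fun s hs => ?_⟩
  have hlip' : LipschitzOnWith (max 1 K) (fun y : E × E => (y.2, S y)) U :=
    (LipschitzWith.prod_snd.lipschitzOnWith).prodMk hlip
  have hord : (J ∩ Metric.ball t ε).OrdConnected := by
    rw [Real.ball_eq_Ioo]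
    exact hγ.ordConnected.inter ordConnected_Ioo
  have hmem : ∀ s ∈ J ∩ Metric.ball t ε, _ := fun s hs => hball ⟨hs.2, hs.1⟩
  have hEq := eqOn_of_hasDerivWithinAt hlip' hord
    (fun s hs => ((hmem s hs).1.2.2).mono inter_subset_left) (fun s hs => (hmem s hs).1.2.1)
    (fun s hs => ((hmem s hs).2.2.2).mono inter_subset_left) (fun s hs => (hmem s hs).2.2.1)
    ⟨ht, Metric.mem_ball_self hε⟩ hz0 hs
  exact (extChartAt 𝓘(ℝ, E) q).injOn (hmem s hs).1.1 (hmem s hs).2.1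
    (congrArg (fun p : E × E => p.1) hEq)

/-- Two geodesics on the same interval with the same position and velocity at one time agree. -/
theorem IsGeodesicOn.eqOn [FiniteDimensional ℝ E] [T2Space M] (hF : IsFinslerMetric F)
    (hγ : IsGeodesicOn F J γ) (hδ : IsGeodesicOn F J δ) {t₀ : ℝ} (ht₀ : t₀ ∈ J) {q : M}
    (hq : γ t₀ ∈ (extChartAt 𝓘(ℝ, E) q).source) (heq : γ t₀ = δ t₀)
    (hvel : derivWithin (fun s => extChartAt 𝓘(ℝ, E) q (γ s)) J t₀
      = derivWithin (fun s => extChartAt 𝓘(ℝ, E) q (δ s)) J t₀) :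
    EqOn γ δ J := by
  -- The set of times near which the curves agree is open. Relative to `J` it is also closed: at a
  -- limit time positions and velocities agree by continuity (the target is Hausdorff), and local
  -- uniqueness applies again. Connectedness of `J` concludes.
  set A : Set ℝ := {t | ∃ ε > 0, EqOn γ δ (J ∩ Metric.ball t ε)} with hA
  have hAo : IsOpen A := by
    rw [Metric.isOpen_iff]
    rintro t ⟨ε, hε, h⟩
    refine ⟨ε / 2, half_pos hε, fun s hs => ⟨ε / 2, half_pos hε, h.mono ?_⟩⟩
    refine inter_subset_inter_right _ (Metric.ball_subset_ball' ?_)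
    rw [Metric.mem_ball] at hs
    linarith
  have hJA : J ⊆ A := by
    have : PreconnectedSpace J :=
      isPreconnected_iff_preconnectedSpace.1 hγ.ordConnected.isPreconnected
    suffices hcl : IsClosed ((↑) ⁻¹' A : Set J) by
      have huniv := IsClopen.eq_univ ⟨hcl, hAo.preimage continuous_subtype_val⟩
        ⟨⟨t₀, ht₀⟩, hγ.eventually_eq hF hδ ht₀ hq heq hvel⟩
      intro t ht
      exact huniv.symm.subset (mem_univ (⟨t, ht⟩ : J))
    rw [← closure_subset_iff_isClosed]
    rintro ⟨t, ht⟩ htA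
    rw [closure_subtype, Subtype.image_preimage_coe, mem_closure_iff_nhdsWithin_neBot] at htA
    change t ∈ A
    have hsub : 𝓝[J ∩ A] t ≤ 𝓝[J] t := nhdsWithin_mono _ inter_subset_left
    have hpt : ∀ s ∈ J ∩ A, γ s = δ s := by
      rintro s ⟨hsJ, ε, hε, hs⟩
      exact hs ⟨hsJ, Metric.mem_ball_self hε⟩
    have heq' : γ t = δ t := by
      refine tendsto_nhds_unique ((hγ.smooth t ht).continuousWithinAt.tendsto.mono_left hsub)
        (((hδ.smooth t ht).continuousWithinAt.tendsto.mono_left hsub).congr' ?_)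
      filter_upwards [self_mem_nhdsWithin] with s hs
      exact (hpt s hs).symm
    have hqt : γ t ∈ (extChartAt 𝓘(ℝ, E) (γ t)).source := mem_extChartAt_source _
    refine hγ.eventually_eq hF hδ ht hqt heq' ?_
    refine tendsto_nhds_unique
      ((hγ.contDiffWithinAt_derivWithin ht hqt).continuousWithinAt.tendsto.mono_left hsub)
      (((hδ.contDiffWithinAt_derivWithin ht
        (heq' ▸ hqt)).continuousWithinAt.tendsto.mono_left hsub).congr' ?_)
    filter_upwards [self_mem_nhdsWithin] with s hs
    obtain ⟨hsJ, ε, hε, hs'⟩ := hs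
    refine Filter.EventuallyEq.derivWithin_eq ?_ ?_
    · filter_upwards [inter_mem_nhdsWithin J (Metric.ball_mem_nhds s hε)] with r hr
      exact congrArg _ (hs' hr).symm
    · exact congrArg _ (hs' ⟨hsJ, Metric.mem_ball_self hε⟩).symm
  intro t ht
  obtain ⟨ε, hε, h⟩ := hJA ht
  exact h ⟨ht, Metric.mem_ball_self hε⟩

end Geodesics

/-! ### Regularity of integral curves. -/

section Bootstrap

variable {E : Type*} [NormedAddCommGroup E] [NormedSpace ℝ E]

/-- Integral curves of smooth vector fields are smooth. -/
theorem contDiffAt_of_hasDerivAt_comp {f : ℝ → E} {w : E → E} {t₀ : ℝ}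
    (hw : ContDiffAt ℝ ∞ w (f t₀)) (hf : ∀ᶠ t in 𝓝 t₀, HasDerivAt f (w (f t)) t) :
    ContDiffAt ℝ ∞ f t₀ := by
  rw [contDiffAt_infty]
  -- The order is fixed before the neighbourhood `V` is chosen: smoothness at a point provides one
  -- neighbourhood for each finite order, not a common one.
  intro n
  have h1 : ∀ᶠ y in 𝓝 (f t₀), ContDiffAt ℝ n w y :=
    (hw.of_le (by exact_mod_cast le_top)).eventually (by simp)
  have h2 : ∀ᶠ t in 𝓝 t₀, ContDiffAt ℝ n w (f t) :=
    hf.self_of_nhds.continuousAt.eventually h1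
  obtain ⟨V, hV, hVo, htV⟩ := eventually_nhds_iff.1 (h2.and hf)
  -- Since `f' = w ∘ f`, each order of smoothness of `f` yields the next.
  have key : ∀ k : ℕ, k ≤ n → ContDiffOn ℝ k f V := by
    intro k
    induction k with
    | zero =>
      intro _
      rw [Nat.cast_zero, contDiffOn_zero]
      exact fun t ht => (hV t ht).2.continuousAt.continuousWithinAt
    | succ k ih =>
      intro hk
      rw [Nat.cast_succ, contDiffOn_succ_iff_deriv_of_isOpen hVo]
      refine ⟨fun t ht => (hV t ht).2.differentiableAt.differentiableWithinAt, by simp, ?_⟩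
      have h3 : ContDiffOn ℝ k (w ∘ f) V := fun t ht =>
        ((hV t ht).1.of_le (by exact_mod_cast (Nat.le_of_succ_le hk))).comp_contDiffWithinAt t
          (ih (Nat.le_of_succ_le hk) t ht)
      exact h3.congr fun t ht => (hV t ht).2.deriv
  exact (key n le_rfl).contDiffAt (hVo.mem_nhds htV)

end Bootstrap

/-! ### Left-invariant fields in a chart, and existence of one-parameter subgroups. -/

section LieGroup

variable {E : Type*} [NormedAddCommGroup E] [NormedSpace ℝ E]
  {G : Type*} [TopologicalSpace G] [ChartedSpace E G] [Group G]

/-- This is the form of smoothness under which left-invariant fields and the bracket of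
`GroupLieAlgebra` are available. -/
theorem lieGroup_minSmoothness [LieGroup 𝓘(ℝ, E) ∞ G] :
    LieGroup 𝓘(ℝ, E) (minSmoothness ℝ 3) G := by
  rw [minSmoothness_of_isRCLikeNormedField]
  infer_instance

theorem mfderiv_eq_fderiv_extChartAt_symm {M : Type*} [TopologicalSpace M] [ChartedSpace E M]
    {E' : Type*} [NormedAddCommGroup E'] [NormedSpace ℝ E'] {f : M → E'} {x : M}
    (hf : MDifferentiableAt 𝓘(ℝ, E) 𝓘(ℝ, E') f x) :
    (mfderiv 𝓘(ℝ, E) 𝓘(ℝ, E') f x : E →L[ℝ] E')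
      = fderiv ℝ (f ∘ (extChartAt 𝓘(ℝ, E) x).symm) (extChartAt 𝓘(ℝ, E) x x) := by
  rw [hf.mfderiv, modelWithCornersSelf_coe, range_id, fderivWithin_univ]
  rfl

theorem hasDerivAt_of_hasMFDerivAt {f : ℝ → E} {t : ℝ} {L : ℝ →L[ℝ] E}
    (h : HasMFDerivAt 𝓘(ℝ, ℝ) 𝓘(ℝ, E) f t L) : HasDerivAt f (L 1) t := by
  have h' : HasFDerivAt f L t := hasMFDerivAt_iff_hasFDerivAt.1 h
  exact h'.hasDerivAt

/-- A smooth curve through `x` in the preferred chart at `x` has the same velocity. -/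
theorem hasDerivAt_extChartAt {M : Type*} [TopologicalSpace M] [ChartedSpace E M]
    [IsManifold 𝓘(ℝ, E) ∞ M] {c : ℝ → M} {t : ℝ} {x : M}
    (hc : MDifferentiableAt 𝓘(ℝ, ℝ) 𝓘(ℝ, E) c t) (hx : c t = x) :
    HasDerivAt (fun s => extChartAt 𝓘(ℝ, E) x (c s))
      (mfderiv 𝓘(ℝ, ℝ) 𝓘(ℝ, E) c t (1 : ℝ) : E) t := by
  have : IsManifold 𝓘(ℝ, E) 1 M := IsManifold.of_le (n := ∞) (by simp)
  subst hx
  have h1 : HasMFDerivAt 𝓘(ℝ, E) 𝓘(ℝ, E) (extChartAt 𝓘(ℝ, E) (c t)) (c t)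
      (ContinuousLinearMap.id ℝ _) := by
    rw [← mfderiv_extChartAt_self]
    exact (mdifferentiableAt_extChartAt (mem_chart_source _ _)).hasMFDerivAt
  have h2 := h1.comp t hc.hasMFDerivAt
  exact hasDerivAt_of_hasMFDerivAt h2

variable (E G) in
/-- The multiplication of `G` in the preferred chart at the identity. -/
noncomputable def chartMul (z : E × E) : E :=
  extChartAt 𝓘(ℝ, E) (1 : G)
    ((extChartAt 𝓘(ℝ, E) (1 : G)).symm z.1 * (extChartAt 𝓘(ℝ, E) (1 : G)).symm z.2)

theorem mulInvariantVectorField_one (X : GroupLieAlgebra 𝓘(ℝ, E) G) :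
    mulInvariantVectorField X (1 : G) = X := by
  have h : (fun k : G => 1 * k) = id := by
    ext k
    simp
  rw [mulInvariantVectorField]
  change (mfderiv 𝓘(ℝ, E) 𝓘(ℝ, E) (fun k : G => 1 * k) 1 : E →L[ℝ] E) X = X
  rw [h]
  exact congrArg (fun L : E →L[ℝ] E => L X) (mfderiv_id (I := 𝓘(ℝ, E)) (x := (1 : G)))

variable (E G) in
theorem eventually_chartMul_one_left : ∀ᶠ y in 𝓝 (extChartAt 𝓘(ℝ, E) (1 : G) 1),
    chartMul E G (extChartAt 𝓘(ℝ, E) (1 : G) 1, y) = y := by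
  filter_upwards [extChartAt_target_mem_nhds (I := 𝓘(ℝ, E)) (1 : G)] with y hy
  simp only [chartMul, extChartAt_to_inv, one_mul]
  exact (extChartAt 𝓘(ℝ, E) (1 : G)).right_inv hy

variable (E G) in
theorem eventually_chartMul_one_right : ∀ᶠ y in 𝓝 (extChartAt 𝓘(ℝ, E) (1 : G) 1),
    chartMul E G (y, extChartAt 𝓘(ℝ, E) (1 : G) 1) = y := by
  filter_upwards [extChartAt_target_mem_nhds (I := 𝓘(ℝ, E)) (1 : G)] with y hy
  simp only [chartMul, extChartAt_to_inv, mul_one]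
  exact (extChartAt 𝓘(ℝ, E) (1 : G)).right_inv hy

variable [LieGroup 𝓘(ℝ, E) ∞ G]

variable (E G) in
theorem contMDiffAt_extChartAt_one_symm : ContMDiffAt 𝓘(ℝ, E) 𝓘(ℝ, E) ∞
    (extChartAt 𝓘(ℝ, E) (1 : G)).symm (extChartAt 𝓘(ℝ, E) (1 : G) 1) :=
  (contMDiffOn_extChartAt_symm (1 : G)).contMDiffAt (extChartAt_target_mem_nhds 1)

variable (E G) in
theorem contDiffAt_chartMul :
    ContDiffAt ℝ ∞ (chartMul E G) (extChartAt 𝓘(ℝ, E) (1 : G) 1, extChartAt 𝓘(ℝ, E) (1 : G) 1) := by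
  set e := extChartAt 𝓘(ℝ, E) (1 : G) 1 with he
  have hs := contMDiffAt_extChartAt_one_symm E G
  have h1 : ContMDiffAt 𝓘(ℝ, E × E) 𝓘(ℝ, E) ∞
      (fun z : E × E => (extChartAt 𝓘(ℝ, E) (1 : G)).symm z.1) (e, e) :=
    hs.comp (e, e) contDiff_fst.contMDiff.contMDiffAt
  have h2 : ContMDiffAt 𝓘(ℝ, E × E) 𝓘(ℝ, E) ∞
      (fun z : E × E => (extChartAt 𝓘(ℝ, E) (1 : G)).symm z.2) (e, e) :=
    hs.comp (e, e) contDiff_snd.contMDiff.contMDiffAt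
  have h3 := h1.mul h2
  have h4 : ContMDiffAt 𝓘(ℝ, E) 𝓘(ℝ, E) ∞ (extChartAt 𝓘(ℝ, E) (1 : G))
      ((extChartAt 𝓘(ℝ, E) (1 : G)).symm e * (extChartAt 𝓘(ℝ, E) (1 : G)).symm e) := by
    rw [he, extChartAt_to_inv, mul_one]
    exact contMDiffAt_extChartAt
  exact (h4.comp (e, e) h3).contDiffAt

/-- The derivative of `chartMul` in the second variable is the derivative of a left translation. -/
theorem mfderiv_extChartAt_mul_left {g : G}
    (hg : g ∈ (extChartAt 𝓘(ℝ, E) (1 : G)).source) :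
    (mfderiv 𝓘(ℝ, E) 𝓘(ℝ, E) (fun k : G => extChartAt 𝓘(ℝ, E) (1 : G) (g * k)) 1 : E →L[ℝ] E)
      = fderiv ℝ (fun y => chartMul E G (extChartAt 𝓘(ℝ, E) (1 : G) g, y))
        (extChartAt 𝓘(ℝ, E) (1 : G) 1) := by
  have h1 : ContMDiffAt 𝓘(ℝ, E) 𝓘(ℝ, E) ∞ (extChartAt 𝓘(ℝ, E) (1 : G)) (g * 1) := by
    rw [mul_one]
    exact contMDiffAt_extChartAt' (by rwa [extChartAt_source] at hg)
  have h2 : ContMDiffAt 𝓘(ℝ, E) 𝓘(ℝ, E) ∞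
      (fun k : G => extChartAt 𝓘(ℝ, E) (1 : G) (g * k)) 1 :=
    h1.comp (1 : G) contMDiffAt_mul_left
  rw [mfderiv_eq_fderiv_extChartAt_symm (h2.mdifferentiableAt (by simp))]
  congr 1
  ext y
  simp only [Function.comp_apply, chartMul, (extChartAt 𝓘(ℝ, E) (1 : G)).left_inv hg]

theorem mfderiv_mul_left_mulInvariantVectorField (X : GroupLieAlgebra 𝓘(ℝ, E) G) (g h : G) :
    mfderiv 𝓘(ℝ, E) 𝓘(ℝ, E) (fun k => g * k) h (mulInvariantVectorField X h)
      = mulInvariantVectorField X (g * h) := by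
  have hd : ∀ a b : G, MDifferentiableAt 𝓘(ℝ, E) 𝓘(ℝ, E) (fun k => a * k) b := fun a b =>
    (contMDiff_mul_left (I := 𝓘(ℝ, E)) (n := ∞) (a := a)).contMDiffAt.mdifferentiableAt (by simp)
  have h1 : (fun k : G => g * h * k) = (fun k => g * k) ∘ fun k => h * k := by
    ext k
    simp [mul_assoc]
  simp only [mulInvariantVectorField]
  have h2 := mfderiv_comp (1 : G) (hd g (h * 1)) (hd h 1)
  -- The chain rule produces the base point `h * 1`, whose tangent space is only propositionally
  -- that of `h`; the identity is transported along the equality of points.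
  have key : ∀ h', h * 1 = h' → ∀ v : E,
      (mfderiv 𝓘(ℝ, E) 𝓘(ℝ, E) (fun k => g * k) (h * 1) : E →L[ℝ] E) v
        = (mfderiv 𝓘(ℝ, E) 𝓘(ℝ, E) (fun k => g * k) h' : E →L[ℝ] E) v := by
    rintro _ rfl v
    rfl
  rw [h1]
  exact (key h (mul_one h) _).symm.trans (congrArg (fun L : E →L[ℝ] E => L X) h2).symm

/-- Left translates of integral curves are integral curves. This gives both the completeness of the
field and the homomorphism property of the curve through `1`. -/
theorem hasMFDerivWithinAt_mul_left {X : GroupLieAlgebra 𝓘(ℝ, E) G} {c : ℝ → G} {s : Set ℝ}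
    {t : ℝ} (h : HasMFDerivWithinAt 𝓘(ℝ, ℝ) 𝓘(ℝ, E) c s t
      ((1 : ℝ →L[ℝ] ℝ).smulRight (mulInvariantVectorField X (c t)))) (g : G) :
    HasMFDerivWithinAt 𝓘(ℝ, ℝ) 𝓘(ℝ, E) (fun t => g * c t) s t
      ((1 : ℝ →L[ℝ] ℝ).smulRight (mulInvariantVectorField X (g * c t))) := by
  have h2 := (((contMDiff_mul_left (I := 𝓘(ℝ, E)) (n := ∞) (a := g)).contMDiffAt
    (x := c t)).mdifferentiableAt (by simp)).hasMFDerivAt.comp_hasMFDerivWithinAt t h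
  refine h2.congr_mfderiv (ContinuousLinearMap.ext fun (r : ℝ) => Eq.symm ?_)
  change (r : ℝ) • (mulInvariantVectorField X (g * c t) : E)
    = (mfderiv 𝓘(ℝ, E) 𝓘(ℝ, E) (fun k => g * k) (c t) : E →L[ℝ] E)
      ((r : ℝ) • (mulInvariantVectorField X (c t) : E))
  rw [← mfderiv_mul_left_mulInvariantVectorField]
  exact (map_smul (mfderiv 𝓘(ℝ, E) 𝓘(ℝ, E) (fun k => g * k) (c t) : E →L[ℝ] E) _ _).symm

/-- The left-invariant vector field of `X` in the preferred chart at the identity. -/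
theorem eventually_chartMul_eq (X : GroupLieAlgebra 𝓘(ℝ, E) G) :
    ∀ᶠ g in 𝓝 (1 : G), (mfderiv 𝓘(ℝ, E) 𝓘(ℝ, E) (extChartAt 𝓘(ℝ, E) (1 : G)) g : E →L[ℝ] E)
        (mulInvariantVectorField X g)
      = fderiv ℝ (chartMul E G)
        (extChartAt 𝓘(ℝ, E) (1 : G) g, extChartAt 𝓘(ℝ, E) (1 : G) 1) (0, X) := by
  have hd : ∀ᶠ z in 𝓝 (extChartAt 𝓘(ℝ, E) (1 : G) 1, extChartAt 𝓘(ℝ, E) (1 : G) 1),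
      ContDiffAt ℝ 1 (chartMul E G) z :=
    ((contDiffAt_chartMul E G).of_le (by exact_mod_cast le_top)).eventually (by simp)
  have hc : ContinuousAt (fun g : G => (extChartAt 𝓘(ℝ, E) (1 : G) g,
      extChartAt 𝓘(ℝ, E) (1 : G) 1)) 1 :=
    (continuousAt_extChartAt 1).prodMk continuousAt_const
  filter_upwards [hc.eventually hd, extChartAt_source_mem_nhds (I := 𝓘(ℝ, E)) (1 : G)] with g hg hgs
  have h1 := mfderiv_extChartAt_mul_left hgs
  have h2 : fderiv ℝ (fun y => chartMul E G (extChartAt 𝓘(ℝ, E) (1 : G) g, y))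
      (extChartAt 𝓘(ℝ, E) (1 : G) 1) X = fderiv ℝ (chartMul E G)
        (extChartAt 𝓘(ℝ, E) (1 : G) g, extChartAt 𝓘(ℝ, E) (1 : G) 1) (0, X) := by
    have h3 := (hg.differentiableAt (by simp)).hasFDerivAt.comp _
      (hasFDerivAt_prodMk_right (𝕜 := ℝ) (extChartAt 𝓘(ℝ, E) (1 : G) g)
        (extChartAt 𝓘(ℝ, E) (1 : G) 1))
    exact congrArg (fun L : E →L[ℝ] E => L X) h3.fderiv
  rw [← h2, ← h1]
  have h4 : MDifferentiableAt 𝓘(ℝ, E) 𝓘(ℝ, E) (extChartAt 𝓘(ℝ, E) (1 : G)) (g * 1) := by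
    rw [mul_one]
    exact (contMDiffAt_extChartAt' (n := ∞)
      (by rwa [extChartAt_source] at hgs)).mdifferentiableAt (by simp)
  have h5 : MDifferentiableAt 𝓘(ℝ, E) 𝓘(ℝ, E) (fun k => g * k) (1 : G) :=
    (contMDiff_mul_left (I := 𝓘(ℝ, E)) (n := ∞) (a := g)).contMDiffAt.mdifferentiableAt (by simp)
  have h6 := mfderiv_comp (1 : G) h4 h5
  have key : ∀ g', g * 1 = g' → ∀ v : E,
      (mfderiv 𝓘(ℝ, E) 𝓘(ℝ, E) (extChartAt 𝓘(ℝ, E) (1 : G)) (g * 1) : E →L[ℝ] E) v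
        = (mfderiv 𝓘(ℝ, E) 𝓘(ℝ, E) (extChartAt 𝓘(ℝ, E) (1 : G)) g' : E →L[ℝ] E) v := by
    rintro _ rfl v
    rfl
  exact (key g (mul_one g) _).symm.trans (congrArg (fun L : E →L[ℝ] E => L X) h6).symm

theorem contDiffAt_fderiv_chartMul (v : E × E) : ContDiffAt ℝ ∞
    (fun x => fderiv ℝ (chartMul E G) (x, extChartAt 𝓘(ℝ, E) (1 : G) 1) v)
    (extChartAt 𝓘(ℝ, E) (1 : G) 1) := by
  have h1 : ContDiffAt ℝ ∞ (fderiv ℝ (chartMul E G))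
      (extChartAt 𝓘(ℝ, E) (1 : G) 1, extChartAt 𝓘(ℝ, E) (1 : G) 1) :=
    (contDiffAt_chartMul E G).fderiv_right (by simp)
  have h2 : ContDiffAt ℝ ∞ (fun x => fderiv ℝ (chartMul E G) (x, extChartAt 𝓘(ℝ, E) (1 : G) 1))
      (extChartAt 𝓘(ℝ, E) (1 : G) 1) :=
    h1.comp (f := fun x : E => (x, extChartAt 𝓘(ℝ, E) (1 : G) 1)) _
      (contDiffAt_id.prodMk contDiffAt_const)
  exact h2.clm_apply contDiffAt_const

/-- In the chart at `1` the field is `x ↦ D₂μ(x, e) X`, with `μ` the multiplication; it is smooth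
near `e`, so the bootstrap for integral curves applies. -/
theorem contMDiffAt_of_isMIntegralCurve {X : GroupLieAlgebra 𝓘(ℝ, E) G} {c : ℝ → G}
    (h0 : c 0 = 1) (hc : IsMIntegralCurve (I := 𝓘(ℝ, E)) c (mulInvariantVectorField X)) :
    ContMDiffAt 𝓘(ℝ, ℝ) 𝓘(ℝ, E) ∞ c 0 := by
  have hcont : ContinuousAt c 0 := (hc 0).continuousAt
  have hsrc : ∀ᶠ t in 𝓝 (0 : ℝ), c t ∈ (extChartAt 𝓘(ℝ, E) (1 : G)).source :=
    hcont.eventually (by rw [h0]; exact extChartAt_source_mem_nhds (I := 𝓘(ℝ, E)) (1 : G))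
  have hfield : ∀ᶠ t in 𝓝 (0 : ℝ), _ :=
    hcont.eventually (by rw [h0]; exact eventually_chartMul_eq X)
  have hu : ContDiffAt ℝ ∞ (fun t => extChartAt 𝓘(ℝ, E) (1 : G) (c t)) 0 := by
    refine contDiffAt_of_hasDerivAt_comp (w := fun x => fderiv ℝ (chartMul E G)
      (x, extChartAt 𝓘(ℝ, E) (1 : G) 1) (0, X)) ?_ ?_
    · rw [h0]
      exact contDiffAt_fderiv_chartMul _
    · filter_upwards [hsrc, hfield] with t ht1 ht2
      rw [← ht2]
      have h1 : MDifferentiableAt 𝓘(ℝ, E) 𝓘(ℝ, E) (extChartAt 𝓘(ℝ, E) (1 : G)) (c t) :=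
        (contMDiffAt_extChartAt' (n := ∞)
          (by rwa [extChartAt_source] at ht1)).mdifferentiableAt (by simp)
      have h2 := hasDerivAt_of_hasMFDerivAt (h1.hasMFDerivAt.comp t (hc t))
      refine h2.congr_deriv ?_
      change (mfderiv 𝓘(ℝ, E) 𝓘(ℝ, E) (extChartAt 𝓘(ℝ, E) (1 : G)) (c t) : E →L[ℝ] E)
        ((1 : ℝ) • (mulInvariantVectorField X (c t) : E)) = _
      rw [one_smul]
  have h1 : ContMDiffAt 𝓘(ℝ, E) 𝓘(ℝ, E) ∞ (extChartAt 𝓘(ℝ, E) (1 : G)).symm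
      (extChartAt 𝓘(ℝ, E) (1 : G) (c 0)) := by
    rw [h0]
    exact contMDiffAt_extChartAt_one_symm E G
  refine (h1.comp (0 : ℝ) hu.contMDiffAt).congr_of_eventuallyEq ?_
  filter_upwards [hsrc] with t ht
  exact ((extChartAt 𝓘(ℝ, E) (1 : G)).left_inv ht).symm

/-- Every element of the Lie algebra generates a one-parameter subgroup. -/
theorem exists_isOneParameterSubgroup [FiniteDimensional ℝ E] [T2Space G]
    (X : GroupLieAlgebra 𝓘(ℝ, E) G) : ∃ c : ℝ → G, IsOneParameterSubgroup X c := by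
  have : LieGroup 𝓘(ℝ, E) (minSmoothness ℝ 3) G := lieGroup_minSmoothness
  have : CompleteSpace E := FiniteDimensional.complete ℝ E
  have : IsManifold 𝓘(ℝ, E) 1 G := IsManifold.of_le (n := ∞) (by simp)
  have hv : ContMDiff 𝓘(ℝ, E) (𝓘(ℝ, E).tangent) 1
      (fun g : G => (⟨g, mulInvariantVectorField X g⟩ : TangentBundle 𝓘(ℝ, E) G)) :=
    (contMDiff_mulInvariantVectorField X).of_le
      (by rw [minSmoothness_of_isRCLikeNormedField]; norm_num)
  obtain ⟨c, h0, hc⟩ : ∃ c : ℝ → G, c 0 = 1 ∧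
      IsMIntegralCurve (I := 𝓘(ℝ, E)) c (mulInvariantVectorField X) := by
    -- Translating the local curve through `1` gives integral curves through every `g` with the same
    -- existence time `ε`, so they extend to all of `ℝ`.
    obtain ⟨c, hc0, hc⟩ := exists_isMIntegralCurveAt_of_contMDiffAt_boundaryless
      (t₀ := 0) (hv.contMDiffAt (x := (1 : G)))
    obtain ⟨ε, hε, hball⟩ := isMIntegralCurveAt_iff'.1 hc
    refine exists_isMIntegralCurve_of_isMIntegralCurveOn hv hε (fun g => ?_) 1
    rw [Real.ball_eq_Ioo, zero_sub, zero_add] at hball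
    exact ⟨fun t => g * c t, by simp [hc0], fun t ht =>
      hasMFDerivWithinAt_mul_left (hball t ht) g⟩
  have hadd : ∀ s t, c (s + t) = c s * c t := by
    intro s t
    -- `t ↦ c(s + t)` and `t ↦ c(s) c(t)` are integral curves of the same field with the same value
    -- at `0`.
    have h1 : IsMIntegralCurve (I := 𝓘(ℝ, E)) (fun t => c s * c t) (mulInvariantVectorField X) := by
      rw [isMIntegralCurve_iff_isMIntegralCurveOn] at hc ⊢
      exact fun t ht => hasMFDerivWithinAt_mul_left (hc t ht) (c s)
    have h2 := isMIntegralCurve_Ioo_eq_of_contMDiff_boundaryless (t₀ := 0) hv (hc.comp_add s) h1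
      (by simp [h0])
    rw [add_comm]
    exact congrFun h2 t
  refine ⟨c, h0, hadd, fun t => ?_, ?_⟩
  · have h1 : c = fun s => c t * c (s - t) := by
      ext s
      rw [← hadd, add_sub_cancel]
    have h2 := contMDiffAt_of_isMIntegralCurve h0 hc
    rw [← sub_self t] at h2
    rw [h1]
    exact contMDiffAt_const.mul
      (h2.comp (g := c) (f := fun s : ℝ => s - t) t
        (contDiff_id.sub contDiff_const).contMDiff.contMDiffAt)
  · rw [(hc 0).mfderiv, h0, mulInvariantVectorField_one]
    exact one_smul ℝ (X : E)

end LieGroup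

end FinslerHomogeneous

namespace FinslerHomogeneous

open Set Filter Topology VectorField

/-! ### The derivative of the adjoint action is the Lie bracket. -/

section Calculus

variable {E : Type*} [NormedAddCommGroup E] [NormedSpace ℝ E]

theorem lieBracketWithin_univ_eq_of_eventuallyEq {V W V' W' : E → E} {x : E}
    (hV : V =ᶠ[𝓝 x] V') (hW : W =ᶠ[𝓝 x] W') :
    lieBracketWithin ℝ V W univ x = fderiv ℝ W' x (V' x) - fderiv ℝ V' x (W' x) := by
  rw [lieBracketWithin_univ, Filter.EventuallyEq.lieBracket_vectorField_eq hV hW, lieBracket]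

/-- The infinitesimal form of conjugation: `μ` is a local multiplication with unit `e`, `u` is a
curve through `e`, and `κ (r, ·)` is the conjugation by the inverse of `u r`. -/
theorem hasDerivAt_fderiv_conj {μ : E × E → E} {e : E} {κ : ℝ × E → E} {u : ℝ → E} {Z : E}
    (hμ : ContDiffAt ℝ ∞ μ (e, e)) (hμl : ∀ v, fderiv ℝ μ (e, e) (v, 0) = v)
    (hμr : ∀ v, fderiv ℝ μ (e, e) (0, v) = v) (hκ : ContDiffAt ℝ ∞ κ (0, e))
    (hκe : ∀ r, κ (r, e) = e) (hu : HasDerivAt u Z 0) (hu0 : u 0 = e)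
    (hrel : ∀ᶠ p in 𝓝 ((0 : ℝ), e), μ (u p.1, κ p) = μ (p.2, u p.1)) (X : E) :
    HasDerivAt (fun r => fderiv ℝ κ (r, e) (0, X))
      (fderiv ℝ (fderiv ℝ μ) (e, e) (X, 0) (0, Z) - fderiv ℝ (fderiv ℝ μ) (e, e) (Z, 0) (0, X))
      0 := by
  have hDμ : ContDiffAt ℝ ∞ (fderiv ℝ μ) (e, e) := hμ.fderiv_right (by simp)
  set Θ : ℝ → E := fun r => fderiv ℝ κ (r, e) (0, X) with hΘ
  have hline : Tendsto (fun r : ℝ => (r, e)) (𝓝 0) (𝓝 (0, e)) :=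
    (Continuous.prodMk_left e).tendsto 0
  have hΘd : HasDerivAt Θ (deriv Θ 0) 0 := by
    have h1 : ContDiffAt ℝ ∞ (fderiv ℝ κ) (0, e) := hκ.fderiv_right (by simp)
    have h2 : ContDiffAt ℝ ∞ (fun r : ℝ => fderiv ℝ κ (r, e)) 0 :=
      h1.comp (f := fun r : ℝ => (r, e)) 0 (contDiffAt_id.prodMk contDiffAt_const)
    exact ((h2.clm_apply contDiffAt_const).differentiableAt (by simp)).hasDerivAt
  -- The relation `u · (u⁻¹ y u) = y · u`, differentiated in `y` at the unit in the direction `X`.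
  -- Differentiating the result in `r` at `0` isolates the derivative of `Θ`.
  have hder : ∀ᶠ r in 𝓝 (0 : ℝ), fderiv ℝ μ (u r, e) (0, Θ r) = fderiv ℝ μ (e, u r) (X, 0) := by
    have h1 : ∀ᶠ p in 𝓝 ((0 : ℝ), e), ContDiffAt ℝ 1 κ p :=
      (hκ.of_le (by exact_mod_cast le_top)).eventually (by simp)
    have h2 : ∀ᶠ z in 𝓝 (e, e), ContDiffAt ℝ 1 μ z :=
      (hμ.of_le (by exact_mod_cast le_top)).eventually (by simp)
    have h3 : Tendsto (fun r => (u r, e)) (𝓝 0) (𝓝 (e, e)) := by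
      have := hu.continuousAt.tendsto.prodMk_nhds (tendsto_const_nhds (x := e))
      rwa [hu0] at this
    have h4 : Tendsto (fun r => (e, u r)) (𝓝 0) (𝓝 (e, e)) := by
      have := (tendsto_const_nhds (x := e)).prodMk_nhds hu.continuousAt.tendsto
      rwa [hu0] at this
    filter_upwards [hline.eventually h1, h3.eventually h2, h4.eventually h2,
      hline.eventually hrel.eventually_nhds] with r hr1 hr2 hr3 hr4
    have d1 : HasFDerivAt (fun y => κ (r, y))
        (fderiv ℝ κ (r, e) ∘L ContinuousLinearMap.inr ℝ ℝ E) e :=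
      (hr1.differentiableAt (by simp)).hasFDerivAt.comp e (hasFDerivAt_prodMk_right (𝕜 := ℝ) r e)
    have d3 : HasFDerivAt (fun y => μ (u r, κ (r, y))) _ e :=
      HasFDerivAt.comp (g := μ) e (by
        rw [hκe]
        exact (hr2.differentiableAt (by simp)).hasFDerivAt)
        ((hasFDerivAt_const (u r) e).prodMk d1)
    have d4 : HasFDerivAt (fun y => μ (y, u r)) _ e :=
      (hr3.differentiableAt (by simp)).hasFDerivAt.comp (f := fun y => (y, u r)) e
        (hasFDerivAt_prodMk_left (𝕜 := ℝ) e (u r))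
    have hl : ∀ᶠ y in 𝓝 e, μ (u r, κ (r, y)) = μ (y, u r) :=
      ((Continuous.prodMk_right r).tendsto e).eventually hr4
    exact congrArg (fun L : E →L[ℝ] E => L X) (d3.unique (d4.congr_of_eventuallyEq hl))
  have hΘ0 : Θ 0 = X := by
    have := hder.self_of_nhds
    rwa [hu0, hμl, hμr] at this
  set Q := fderiv ℝ (fderiv ℝ μ) (e, e) with hQ
  have hD : HasFDerivAt (fderiv ℝ μ) Q (u 0, e) := by
    rw [hu0]
    exact (hDμ.differentiableAt (by simp)).hasFDerivAt
  have hD' : HasFDerivAt (fderiv ℝ μ) Q (e, u 0) := by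
    rw [hu0]
    exact (hDμ.differentiableAt (by simp)).hasFDerivAt
  have hL : HasDerivAt (fun r => fderiv ℝ μ (u r, e)) (Q (Z, 0)) 0 :=
    hD.comp_hasDerivAt (0 : ℝ) (hu.prodMk (hasDerivAt_const (0 : ℝ) e))
  have hL' : HasDerivAt (fun r => fderiv ℝ μ (e, u r)) (Q (0, Z)) 0 :=
    hD'.comp_hasDerivAt (0 : ℝ) ((hasDerivAt_const (0 : ℝ) e).prodMk hu)
  have hv : HasDerivAt (fun r => ((0 : E), Θ r)) (0, deriv Θ 0) 0 :=
    (hasDerivAt_const (0 : ℝ) (0 : E)).prodMk hΘd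
  have l1 : HasDerivAt (fun r => fderiv ℝ μ (u r, e) (0, Θ r))
      (Q (Z, 0) (0, Θ 0) + fderiv ℝ μ (u 0, e) (0, deriv Θ 0)) 0 :=
    hL.clm_apply hv
  have l2 : HasDerivAt (fun r => fderiv ℝ μ (e, u r) (X, 0)) (Q (0, Z) (X, 0)) 0 := by
    refine (hL'.clm_apply (hasDerivAt_const (0 : ℝ) ((X, 0) : E × E))).congr_deriv ?_
    rw [map_zero, add_zero]
  have l3 := (l1.congr_of_eventuallyEq (hder.mono fun r hr => hr.symm)).unique l2
  rw [hΘ0, hu0, hμr, (hμ.isSymmSndFDerivAt (by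
    rw [minSmoothness_of_isRCLikeNormedField]; exact WithTop.coe_le_coe.2 le_top)).eq (0, Z) (X, 0)] at l3
  rwa [← l3, add_sub_cancel_left]

end Calculus

section Adjoint

variable {E : Type*} [NormedAddCommGroup E] [NormedSpace ℝ E]
  {G : Type*} [TopologicalSpace G] [ChartedSpace E G] [Group G] [LieGroup 𝓘(ℝ, E) ∞ G]

theorem IsOneParameterSubgroup.hasDerivAt_extChartAt {X : GroupLieAlgebra 𝓘(ℝ, E) G} {c : ℝ → G}
    (hc : IsOneParameterSubgroup X c) :
    HasDerivAt (fun t => extChartAt 𝓘(ℝ, E) (1 : G) (c t)) (X : E) 0 := by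
  have h := FinslerHomogeneous.hasDerivAt_extChartAt
    (hc.smooth.contMDiffAt.mdifferentiableAt (by simp)) hc.map_zero
  rwa [hc.velocity] at h

variable (E G) in
theorem fderiv_chartMul_inr (v : E) :
    fderiv ℝ (chartMul E G) (extChartAt 𝓘(ℝ, E) (1 : G) 1, extChartAt 𝓘(ℝ, E) (1 : G) 1) (0, v)
      = v := by
  have h1 := ((contDiffAt_chartMul E G).differentiableAt (by simp)).hasFDerivAt.comp _
    (hasFDerivAt_prodMk_right (𝕜 := ℝ) (extChartAt 𝓘(ℝ, E) (1 : G) 1)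
      (extChartAt 𝓘(ℝ, E) (1 : G) 1))
  have h2 := (hasFDerivAt_id (𝕜 := ℝ) (extChartAt 𝓘(ℝ, E) (1 : G) 1)).congr_of_eventuallyEq
    (eventually_chartMul_one_left E G)
  exact congrArg (fun L : E →L[ℝ] E => L v) (h1.unique h2)

variable (E G) in
theorem fderiv_chartMul_inl (v : E) :
    fderiv ℝ (chartMul E G) (extChartAt 𝓘(ℝ, E) (1 : G) 1, extChartAt 𝓘(ℝ, E) (1 : G) 1) (v, 0)
      = v := by
  have h1 := ((contDiffAt_chartMul E G).differentiableAt (by simp)).hasFDerivAt.comp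
    (f := fun x : E => (x, extChartAt 𝓘(ℝ, E) (1 : G) 1)) _
    (hasFDerivAt_prodMk_left (𝕜 := ℝ) (extChartAt 𝓘(ℝ, E) (1 : G) 1)
      (extChartAt 𝓘(ℝ, E) (1 : G) 1))
  have h2 := (hasFDerivAt_id (𝕜 := ℝ) (extChartAt 𝓘(ℝ, E) (1 : G) 1)).congr_of_eventuallyEq
    (eventually_chartMul_one_right E G)
  exact congrArg (fun L : E →L[ℝ] E => L v) (h1.unique h2)

theorem inverse_apply_of_eq_id {L : E →L[ℝ] E} (h : L = ContinuousLinearMap.id ℝ E) (v : E) :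
    ContinuousLinearMap.inverse L v = v := by
  rw [h, ContinuousLinearMap.inverse_id]
  rfl

/-- The Lie bracket in terms of the second derivative of the multiplication. -/
theorem bracket_eq_fderiv_chartMul (X Z : GroupLieAlgebra 𝓘(ℝ, E) G) :
    (⁅X, Z⁆ : GroupLieAlgebra 𝓘(ℝ, E) G)
      = (fderiv ℝ (fderiv ℝ (chartMul E G))
          (extChartAt 𝓘(ℝ, E) (1 : G) 1, extChartAt 𝓘(ℝ, E) (1 : G) 1) ((X : E), (0 : E)) (0, Z)
        - fderiv ℝ (fderiv ℝ (chartMul E G))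
          (extChartAt 𝓘(ℝ, E) (1 : G) 1, extChartAt 𝓘(ℝ, E) (1 : G) 1) ((Z : E), (0 : E)) (0, X)
          : E) := by
  have : IsManifold 𝓘(ℝ, E) 1 G := IsManifold.of_le (n := ∞) (by simp)
  -- In the chart a left-invariant field is `x ↦ D₂μ(x, e) W`. The bracket of two such fields at `e`
  -- is the antisymmetrized mixed second derivative of `μ`, because `D₂μ(e, e)` is the identity.
  have hpull : ∀ W : GroupLieAlgebra 𝓘(ℝ, E) G,
      (mpullbackWithin 𝓘(ℝ, E) 𝓘(ℝ, E) (extChartAt 𝓘(ℝ, E) (1 : G)).symm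
        (mulInvariantVectorField W) univ : E → E)
      =ᶠ[𝓝 (extChartAt 𝓘(ℝ, E) (1 : G) 1)]
        fun x => fderiv ℝ (chartMul E G) (x, extChartAt 𝓘(ℝ, E) (1 : G) 1) (0, W) := by
    intro W
    have hcs : ContinuousAt (extChartAt 𝓘(ℝ, E) (1 : G)).symm (extChartAt 𝓘(ℝ, E) (1 : G) 1) :=
      continuousAt_extChartAt_symm 1
    have h1 := hcs.eventually (by
      rw [extChartAt_to_inv]
      exact eventually_chartMul_eq W)
    filter_upwards [h1, extChartAt_target_mem_nhds (I := 𝓘(ℝ, E)) (1 : G)] with x hx1 hx2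
    rw [(extChartAt 𝓘(ℝ, E) (1 : G)).right_inv hx2] at hx1
    rw [← hx1, mpullbackWithin_apply]
    have h2 := mfderiv_extChartAt_comp_mfderivWithin_extChartAt_symm hx2
    have h3 := mfderivWithin_extChartAt_symm_comp_mfderiv_extChartAt hx2
    rw [modelWithCornersSelf_coe, range_id] at h2 h3
    rw [ContinuousLinearMap.inverse_eq h3 h2]
  have hQ : ∀ V W : E,
      fderiv ℝ (fun x => fderiv ℝ (chartMul E G) (x, extChartAt 𝓘(ℝ, E) (1 : G) 1) (0, W))
        (extChartAt 𝓘(ℝ, E) (1 : G) 1) (fderiv ℝ (chartMul E G)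
          (extChartAt 𝓘(ℝ, E) (1 : G) 1, extChartAt 𝓘(ℝ, E) (1 : G) 1) (0, V))
      = fderiv ℝ (fderiv ℝ (chartMul E G))
          (extChartAt 𝓘(ℝ, E) (1 : G) 1, extChartAt 𝓘(ℝ, E) (1 : G) 1) (V, 0) (0, W) := by
    intro V W
    rw [fderiv_chartMul_inr]
    have h1 : ContDiffAt ℝ ∞ (fderiv ℝ (chartMul E G))
        (extChartAt 𝓘(ℝ, E) (1 : G) 1, extChartAt 𝓘(ℝ, E) (1 : G) 1) :=
      (contDiffAt_chartMul E G).fderiv_right (by simp)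
    have h2 := (ContinuousLinearMap.apply ℝ E ((0, W) : E × E)).hasFDerivAt.comp
      (extChartAt 𝓘(ℝ, E) (1 : G) 1) ((h1.differentiableAt (by simp)).hasFDerivAt.comp
      (f := fun x : E => (x, extChartAt 𝓘(ℝ, E) (1 : G) 1)) (extChartAt 𝓘(ℝ, E) (1 : G) 1)
      (hasFDerivAt_prodMk_left (𝕜 := ℝ) (extChartAt 𝓘(ℝ, E) (1 : G) 1)
        (extChartAt 𝓘(ℝ, E) (1 : G) 1)))
    exact congrArg (fun L : E →L[ℝ] E => L V) h2.fderiv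
  rw [GroupLieAlgebra.bracket_def, ← mlieBracketWithin_univ, mlieBracketWithin_apply]
  have hid : ∀ v : E, ContinuousLinearMap.inverse
      (mfderiv 𝓘(ℝ, E) 𝓘(ℝ, E) (extChartAt 𝓘(ℝ, E) (1 : G)) 1 : E →L[ℝ] E) v = v :=
    fun v => inverse_apply_of_eq_id
      (by exact mfderiv_extChartAt_self (I := 𝓘(ℝ, E)) (x := (1 : G))) v
  refine (hid _).trans ?_
  rw [preimage_univ, univ_inter, modelWithCornersSelf_coe, range_id]
  have h := lieBracketWithin_univ_eq_of_eventuallyEq (hpull X) (hpull Z)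
  exact h.trans (congrArg₂ (fun a b : E => a - b) (hQ X Z) (hQ Z X))

theorem Ad_eq_mfderiv_extChartAt (a : G) (X : GroupLieAlgebra 𝓘(ℝ, E) G) :
    (Ad a X : E) = fderiv ℝ (fun y => extChartAt 𝓘(ℝ, E) (1 : G)
      (a * (extChartAt 𝓘(ℝ, E) (1 : G)).symm y * a⁻¹)) (extChartAt 𝓘(ℝ, E) (1 : G) 1) (X : E) := by
  have : IsManifold 𝓘(ℝ, E) 1 G := IsManifold.of_le (n := ∞) (by simp)
  have h1 : ContMDiffAt 𝓘(ℝ, E) 𝓘(ℝ, E) ∞ (fun g : G => a * g * a⁻¹) 1 :=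
    (contMDiffAt_const.mul contMDiffAt_id).mul contMDiffAt_const
  have h2 : ∀ g : G, g = 1 → ContMDiffAt 𝓘(ℝ, E) 𝓘(ℝ, E) ∞ (extChartAt 𝓘(ℝ, E) (1 : G)) g := by
    rintro _ rfl
    exact contMDiffAt_extChartAt
  have ha : a * 1 * a⁻¹ = 1 := by group
  have h3 := mfderiv_comp (1 : G) ((h2 _ ha).mdifferentiableAt (by simp))
    (h1.mdifferentiableAt (by simp))
  have h4 := mfderiv_eq_fderiv_extChartAt_symm
    (((h2 _ ha).comp (1 : G) h1).mdifferentiableAt (by simp))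
  have key : ∀ g : G, g = 1 → ∀ v : E,
      (mfderiv 𝓘(ℝ, E) 𝓘(ℝ, E) (extChartAt 𝓘(ℝ, E) (1 : G)) g : E →L[ℝ] E) v = v := by
    rintro _ rfl v
    exact congrArg (fun L : E →L[ℝ] E => L v)
      (mfderiv_extChartAt_self (I := 𝓘(ℝ, E)) (x := (1 : G)))
  have h5 := congrArg (fun L : E →L[ℝ] E => L X) (h3.symm.trans h4)
  exact (key _ ha _).symm.trans h5

/-- The derivative of the adjoint action along a one-parameter subgroup is the Lie bracket. -/
theorem IsOneParameterSubgroup.hasDerivAt_Ad_inv {Z : GroupLieAlgebra 𝓘(ℝ, E) G} {c : ℝ → G}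
    (hc : IsOneParameterSubgroup Z c) (X : GroupLieAlgebra 𝓘(ℝ, E) G) :
    HasDerivAt (fun r => (Ad (c r)⁻¹ X : E)) (⁅X, Z⁆ : GroupLieAlgebra 𝓘(ℝ, E) G) 0 := by
  have hinner : ContMDiffAt 𝓘(ℝ, ℝ × E) 𝓘(ℝ, E) ∞
      (fun p : ℝ × E => (c p.1)⁻¹ * (extChartAt 𝓘(ℝ, E) (1 : G)).symm p.2 * c p.1)
      (0, extChartAt 𝓘(ℝ, E) (1 : G) 1) := by
    have h1 : ContMDiffAt 𝓘(ℝ, ℝ × E) 𝓘(ℝ, E) ∞ (fun p : ℝ × E => c p.1)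
        (0, extChartAt 𝓘(ℝ, E) (1 : G) 1) :=
      hc.smooth.contMDiffAt.comp _ contDiff_fst.contMDiff.contMDiffAt
    have h2 : ContMDiffAt 𝓘(ℝ, ℝ × E) 𝓘(ℝ, E) ∞
        (fun p : ℝ × E => (extChartAt 𝓘(ℝ, E) (1 : G)).symm p.2)
        (0, extChartAt 𝓘(ℝ, E) (1 : G) 1) :=
      (contMDiffAt_extChartAt_one_symm E G).comp (0, extChartAt 𝓘(ℝ, E) (1 : G) 1)
        contDiff_snd.contMDiff.contMDiffAt
    exact (h1.inv.mul h2).mul h1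
  have hinner0 : ∀ r, (c r)⁻¹ * (extChartAt 𝓘(ℝ, E) (1 : G)).symm
      (extChartAt 𝓘(ℝ, E) (1 : G) 1) * c r = 1 := by
    intro r
    rw [extChartAt_to_inv]
    group
  have hκs : ContDiffAt ℝ ∞ (fun p : ℝ × E => extChartAt 𝓘(ℝ, E) (1 : G)
      ((c p.1)⁻¹ * (extChartAt 𝓘(ℝ, E) (1 : G)).symm p.2 * c p.1))
      (0, extChartAt 𝓘(ℝ, E) (1 : G) 1) := by
    have h1 : ContMDiffAt 𝓘(ℝ, E) 𝓘(ℝ, E) ∞ (extChartAt 𝓘(ℝ, E) (1 : G)) ((c 0)⁻¹ *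
        (extChartAt 𝓘(ℝ, E) (1 : G)).symm (extChartAt 𝓘(ℝ, E) (1 : G) 1) * c 0) := by
      rw [hinner0]
      exact contMDiffAt_extChartAt
    exact (h1.comp (0, extChartAt 𝓘(ℝ, E) (1 : G) 1) hinner).contDiffAt
  have hcsrc : ∀ᶠ r in 𝓝 (0 : ℝ), c r ∈ (extChartAt 𝓘(ℝ, E) (1 : G)).source :=
    hc.smooth.continuous.continuousAt.eventually
      (by rw [hc.map_zero]; exact extChartAt_source_mem_nhds (I := 𝓘(ℝ, E)) (1 : G))
  have hrel : ∀ᶠ p in 𝓝 ((0 : ℝ), extChartAt 𝓘(ℝ, E) (1 : G) 1),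
      chartMul E G (extChartAt 𝓘(ℝ, E) (1 : G) (c p.1), extChartAt 𝓘(ℝ, E) (1 : G)
        ((c p.1)⁻¹ * (extChartAt 𝓘(ℝ, E) (1 : G)).symm p.2 * c p.1))
      = chartMul E G (p.2, extChartAt 𝓘(ℝ, E) (1 : G) (c p.1)) := by
    have h1 : ∀ᶠ p in 𝓝 ((0 : ℝ), extChartAt 𝓘(ℝ, E) (1 : G) 1),
        (c p.1)⁻¹ * (extChartAt 𝓘(ℝ, E) (1 : G)).symm p.2 * c p.1
          ∈ (extChartAt 𝓘(ℝ, E) (1 : G)).source := by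
      refine hinner.continuousAt.eventually ?_
      simp only [hinner0]
      exact extChartAt_source_mem_nhds (I := 𝓘(ℝ, E)) (1 : G)
    filter_upwards [h1, continuousAt_fst.eventually hcsrc] with p hp1 hp2
    simp only [chartMul, (extChartAt 𝓘(ℝ, E) (1 : G)).left_inv hp1,
      (extChartAt 𝓘(ℝ, E) (1 : G)).left_inv hp2]
    congr 1
    group
  have key := hasDerivAt_fderiv_conj (contDiffAt_chartMul E G) (fderiv_chartMul_inl E G)
    (fderiv_chartMul_inr E G) hκs (fun r => by simp only [hinner0]) hc.hasDerivAt_extChartAt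
    (by rw [hc.map_zero]) hrel X
  rw [bracket_eq_fderiv_chartMul]
  refine key.congr_of_eventuallyEq ?_
  have h1 := hκs.of_le (m := 1) (by exact_mod_cast le_top)
  filter_upwards [((Continuous.prodMk_left (extChartAt 𝓘(ℝ, E) (1 : G) 1)).tendsto
    (0 : ℝ)).eventually (h1.eventually (by simp))] with r hr
  rw [Ad_eq_mfderiv_extChartAt, inv_inv]
  have h2 := (hr.differentiableAt (by simp)).hasFDerivAt.comp (extChartAt 𝓘(ℝ, E) (1 : G) 1)
    (hasFDerivAt_prodMk_right (𝕜 := ℝ) r (extChartAt 𝓘(ℝ, E) (1 : G) 1))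
  exact congrArg (fun L : E →L[ℝ] E => L X) h2.fderiv

end Adjoint

/-! ### Local sections of submersions. -/

section Submersion

variable {E E' : Type*} [NormedAddCommGroup E] [NormedSpace ℝ E]
  [NormedAddCommGroup E'] [NormedSpace ℝ E']
  {M N : Type*} [TopologicalSpace M] [ChartedSpace E M] [TopologicalSpace N] [ChartedSpace E' N]

/-- A submersion has local sections. -/
theorem exists_local_section {f : M → N} {x : M}
    (h : Manifold.IsSubmersionAt 𝓘(ℝ, E) 𝓘(ℝ, E') ∞ f x) :
    ∃ σ : N → M, σ (f x) = x ∧ MDifferentiableAt 𝓘(ℝ, E') 𝓘(ℝ, E) σ (f x) ∧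
      ∀ᶠ y in 𝓝 (f x), f (σ y) = y := by
  set φ := h.domChart.extend 𝓘(ℝ, E) with hφ
  set ψ := h.codChart.extend 𝓘(ℝ, E') with hψ
  have hxs : x ∈ φ.source := by
    rw [hφ, OpenPartialHomeomorph.extend_source]
    exact h.mem_domChart_source
  have hfx : f x ∈ ψ.source := by
    rw [hψ, OpenPartialHomeomorph.extend_source]
    exact h.mem_codChart_source
  have hw : ∀ z ∈ φ.target, ψ (f (φ.symm z)) = (h.equiv z).1 := fun z hz => h.writtenInCharts hz
  have hx1 : (h.equiv (φ x)).1 = ψ (f x) := by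
    rw [← hw _ (φ.map_source hxs), φ.left_inv hxs]
  -- In adapted charts `f` is a linear projection; the section keeps the complementary coordinate at
  -- its value at `x`.
  set j : N → E := fun y => h.equiv.symm (ψ y, (h.equiv (φ x)).2) with hj
  have hjx : j (f x) = φ x := by
    rw [hj]
    simp only
    rw [← hx1, Prod.mk.eta, ContinuousLinearEquiv.symm_apply_apply]
  have hψd : ContMDiffAt 𝓘(ℝ, E') 𝓘(ℝ, E') ∞ ψ (f x) :=
    h.codChart.contMDiffAt_extend (I := 𝓘(ℝ, E')) h.codChart_mem_maximalAtlas
      h.mem_codChart_source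
  have hjd : ContMDiffAt 𝓘(ℝ, E') 𝓘(ℝ, E) ∞ j (f x) :=
    (h.equiv.symm.contDiff.contMDiff.contMDiffAt).comp (f x)
      (ContMDiffAt.prodMk_space hψd contMDiffAt_const)
  have hto : IsOpen φ.target := by
    have := h.domChart.isOpen_extend_target (I := 𝓘(ℝ, E))
    exact this
  have hφd : ContMDiffAt 𝓘(ℝ, E) 𝓘(ℝ, E) ∞ φ.symm (j (f x)) := by
    rw [hjx]
    have := contMDiffOn_extend_symm (I := 𝓘(ℝ, E)) h.domChart_mem_maximalAtlas
    refine this.contMDiffAt ?_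
    rw [modelWithCornersSelf_coe, image_id]
    exact h.domChart.open_target.mem_nhds (h.domChart.map_source h.mem_domChart_source)
  refine ⟨fun y => φ.symm (j y), ?_, (hφd.comp (f x) hjd).mdifferentiableAt (by simp), ?_⟩
  · simp only
    rw [hjx, φ.left_inv hxs]
  · have h1 : ∀ᶠ y in 𝓝 (f x), j y ∈ φ.target :=
      hjd.continuousAt.eventually (by
        rw [hjx]
        exact hto.mem_nhds (φ.map_source hxs))
    have h2 : ∀ᶠ y in 𝓝 (f x), y ∈ h.codChart.source :=
      h.codChart.open_source.mem_nhds h.mem_codChart_source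
    filter_upwards [h1, h2] with y hy1 hy2
    have h3 : φ.symm (j y) ∈ h.domChart.source := by
      have := φ.map_target hy1
      rwa [hφ, OpenPartialHomeomorph.extend_source] at this
    refine ψ.injOn ?_ ?_ ?_
    · rw [hψ, OpenPartialHomeomorph.extend_source]
      exact h.source_subset_preimage_source h3
    · rwa [hψ, OpenPartialHomeomorph.extend_source]
    · rw [hw _ hy1, hj]
      simp

end Submersion

/-! ### The Euler-Lagrange equation from stationarity and a conserved momentum. -/

section Variation

variable {E : Type*} [NormedAddCommGroup E] [NormedSpace ℝ E]

theorem hasFDerivAt_comp_left_line {Ψ : ℝ × ℝ → E} {L : (ℝ × ℝ) →L[ℝ] E} {r s : ℝ}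
    (h : HasFDerivAt Ψ L (r, s)) : HasDerivAt (fun r => Ψ (r, s)) (L (1, 0)) r :=
  h.comp_hasDerivAt r ((hasDerivAt_id r).prodMk (hasDerivAt_const r s))

theorem hasFDerivAt_comp_right_line {Ψ : ℝ × ℝ → E} {L : (ℝ × ℝ) →L[ℝ] E} {r s : ℝ}
    (h : HasFDerivAt Ψ L (r, s)) : HasDerivAt (fun s => Ψ (r, s)) (L (0, 1)) s :=
  h.comp_hasDerivAt s ((hasDerivAt_const s r).prodMk (hasDerivAt_id s))

/-- A Noether-type criterion for the Euler-Lagrange equation. If, for a variation `Ψ` of the curve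
`Ψ (0, ·)`, the Lagrangian is stationary along the variation and the momentum in the direction of
the variation is conserved, then the Euler-Lagrange equation holds in that direction. -/
theorem eulerLagrange_of_variation {L : E × E → ℝ} {Ψ : ℝ × ℝ → E} {t : ℝ}
    (hΨ : ContDiffAt ℝ ∞ Ψ (0, t))
    (hL : ContDiffAt ℝ ∞ L (Ψ (0, t), fderiv ℝ Ψ (0, t) (0, 1)))
    (hstat : HasDerivAt (fun r => L (Ψ (r, t), fderiv ℝ Ψ (r, t) (0, 1))) 0 0) {C : ℝ}
    (hcons : ∀ᶠ s in 𝓝 t, fderiv ℝ L (Ψ (0, s), fderiv ℝ Ψ (0, s) (0, 1))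
      (0, fderiv ℝ Ψ (0, s) (1, 0)) = C) :
    fderiv ℝ (fderiv ℝ L) (Ψ (0, t), fderiv ℝ Ψ (0, t) (0, 1))
        (fderiv ℝ Ψ (0, t) (0, 1), fderiv ℝ (fderiv ℝ Ψ) (0, t) (0, 1) (0, 1))
        (0, fderiv ℝ Ψ (0, t) (1, 0))
      = fderiv ℝ L (Ψ (0, t), fderiv ℝ Ψ (0, t) (0, 1)) (fderiv ℝ Ψ (0, t) (1, 0), 0) := by
  have hΨd : HasFDerivAt Ψ (fderiv ℝ Ψ (0, t)) ((0 : ℝ), t) :=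
    (hΨ.differentiableAt (by simp)).hasFDerivAt
  have hD : ContDiffAt ℝ ∞ (fderiv ℝ Ψ) (0, t) := hΨ.fderiv_right (by simp)
  have hDd : HasFDerivAt (fderiv ℝ Ψ) (fderiv ℝ (fderiv ℝ Ψ) (0, t)) ((0 : ℝ), t) :=
    (hD.differentiableAt (by simp)).hasFDerivAt
  have hLd : HasFDerivAt L _ (Ψ (0, t), fderiv ℝ Ψ (0, t) (0, 1)) :=
    (hL.differentiableAt (by simp)).hasFDerivAt
  have hLD : HasFDerivAt (fderiv ℝ L) _ (Ψ (0, t), fderiv ℝ Ψ (0, t) (0, 1)) :=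
    ((hL.fderiv_right (m := ∞) (by simp)).differentiableAt (by simp)).hasFDerivAt
  have hev : ∀ v : ℝ × ℝ, HasFDerivAt (fun p => fderiv ℝ Ψ p v)
      ((ContinuousLinearMap.apply ℝ E v) ∘L fderiv ℝ (fderiv ℝ Ψ) (0, t)) ((0 : ℝ), t) :=
    fun v => (ContinuousLinearMap.apply ℝ E v).hasFDerivAt.comp ((0 : ℝ), t) hDd
  have hsymm : fderiv ℝ (fderiv ℝ Ψ) (0, t) (0, 1) (1, 0)
      = fderiv ℝ (fderiv ℝ Ψ) (0, t) (1, 0) (0, 1) :=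
    (hΨ.isSymmSndFDerivAt (by
      rw [minSmoothness_of_isRCLikeNormedField]; exact WithTop.coe_le_coe.2 le_top)).eq _ _
  have hr : HasDerivAt (fun r => (Ψ (r, t), fderiv ℝ Ψ (r, t) (0, 1)))
      (fderiv ℝ Ψ (0, t) (1, 0), fderiv ℝ (fderiv ℝ Ψ) (0, t) (1, 0) (0, 1)) 0 :=
    (hasFDerivAt_comp_left_line hΨd).prodMk (hasFDerivAt_comp_left_line (hev (0, 1)))
  -- Write `w = ∂ᵣΨ`. Stationarity says `L_x(w) + L_y(∂ᵣ∂ₛΨ) = 0`, and conservation says `(d/ds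
  -- L_y)(w) + L_y(∂ₛ∂ᵣΨ) = 0`. The mixed derivatives agree, so subtraction leaves the
  -- Euler-Lagrange equation in the direction `w`.
  have h1 := (hLd.comp_hasDerivAt (0 : ℝ) hr).unique hstat
  have hs : HasDerivAt (fun s => (Ψ (0, s), fderiv ℝ Ψ (0, s) (0, 1)))
      (fderiv ℝ Ψ (0, t) (0, 1), fderiv ℝ (fderiv ℝ Ψ) (0, t) (0, 1) (0, 1)) t :=
    (hasFDerivAt_comp_right_line hΨd).prodMk (hasFDerivAt_comp_right_line (hev (0, 1)))
  have hm : HasDerivAt (fun s => fderiv ℝ L (Ψ (0, s), fderiv ℝ Ψ (0, s) (0, 1)))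
      (fderiv ℝ (fderiv ℝ L) (Ψ (0, t), fderiv ℝ Ψ (0, t) (0, 1))
        (fderiv ℝ Ψ (0, t) (0, 1), fderiv ℝ (fderiv ℝ Ψ) (0, t) (0, 1) (0, 1))) t :=
    hLD.comp_hasDerivAt t hs
  have hw : HasDerivAt (fun s => ((0 : E), fderiv ℝ Ψ (0, s) (1, 0)))
      (0, fderiv ℝ (fderiv ℝ Ψ) (0, t) (0, 1) (1, 0)) t :=
    (hasDerivAt_const t (0 : E)).prodMk (hasFDerivAt_comp_right_line (hev (1, 0)))
  have h2 := ((hm.clm_apply hw).congr_of_eventuallyEq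
    (hcons.mono fun s hs => hs.symm)).unique (hasDerivAt_const t C)
  rw [hsymm] at h2
  set w := fderiv ℝ Ψ (0, t) (1, 0)
  set w' := fderiv ℝ (fderiv ℝ Ψ) (0, t) (1, 0) (0, 1)
  have e : ((w, w') : E × E) = (w, 0) + (0, w') := by simp
  rw [e, map_add] at h1
  linarith

end Variation

section TangentMap

variable {E E' : Type*} [NormedAddCommGroup E] [NormedSpace ℝ E]
  [NormedAddCommGroup E'] [NormedSpace ℝ E']
  {M N : Type*} [TopologicalSpace M] [ChartedSpace E M] [TopologicalSpace N] [ChartedSpace E' N]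

theorem tangentMap_eq_of_eventuallyEq {f f' : M → N} {p : TangentBundle 𝓘(ℝ, E) M}
    (h : f =ᶠ[𝓝 p.1] f') :
    tangentMap 𝓘(ℝ, E) 𝓘(ℝ, E') f p = tangentMap 𝓘(ℝ, E) 𝓘(ℝ, E') f' p := by
  have key : ∀ (a b : N) (v w : E'), a = b → v = w →
      (⟨a, v⟩ : TangentBundle 𝓘(ℝ, E') N) = ⟨b, w⟩ := by
    rintro a _ v _ rfl rfl
    rfl
  exact key _ _ _ _ h.eq_of_nhds
    (congrArg (fun L : E →L[ℝ] E' => L p.2) (Filter.EventuallyEq.mfderiv_eq h))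

end TangentMap

/-! ### Definiteness of the metric. -/

section Norm

variable {E : Type*} [NormedAddCommGroup E] [NormedSpace ℝ E]
  {M : Type*} [TopologicalSpace M] [ChartedSpace E M] [IsManifold 𝓘(ℝ, E) ∞ M]
  {F : TangentBundle 𝓘(ℝ, E) M → ℝ}

theorem IsFinslerMetric.localF_pos (hF : IsFinslerMetric F) {q : M} {x y : E}
    (hx : x ∈ (extChartAt 𝓘(ℝ, E) q).target) (hy : y ≠ 0) : 0 < localF F q x y := by
  have h1 := hF.localG_pos hx hy hy
  rw [hF.localG_self hx hy, energy] at h1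
  have h3 : 0 ≤ localF F q x y := hF.nonneg _
  rcases h3.eq_or_lt with h | h
  · simp [← h] at h1
  · exact h

theorem IsFinslerMetric.localF_zero (hF : IsFinslerMetric F) (q : M) (x : E) :
    localF F q x 0 = 0 := by
  have := hF.localF_smul q x 0 le_rfl
  simpa using this

theorem IsFinslerMetric.localF_eq_zero_iff (hF : IsFinslerMetric F) {q : M} {x y : E}
    (hx : x ∈ (extChartAt 𝓘(ℝ, E) q).target) : localF F q x y = 0 ↔ y = 0 := by
  refine ⟨fun h => ?_, fun h => by rw [h, hF.localF_zero]⟩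
  by_contra hy
  exact (hF.localF_pos hx hy).ne' h

end Norm

/-! ### Velocities of orbits in `G ⧸ H`. -/

section Orbit

variable {EG : Type*} [NormedAddCommGroup EG] [NormedSpace ℝ EG]
  {G : Type*} [TopologicalSpace G] [ChartedSpace EG G] [Group G]
  {H : Subgroup G}
  {E : Type*} [NormedAddCommGroup E] [NormedSpace ℝ E] [ChartedSpace E (G ⧸ H)]

variable (EG E) in
/-- The differential at the identity of `k ↦ g k H`, in the chart of `G ⧸ H` at `q`. -/
noncomputable def orbitDeriv (q : G ⧸ H) (g : G) : EG →L[ℝ] E :=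
  mfderiv 𝓘(ℝ, EG) 𝓘(ℝ, E)
    (fun k : G => extChartAt 𝓘(ℝ, E) q (QuotientGroup.mk (g * k) : G ⧸ H)) 1

theorem IsOneParameterSubgroup.mul_sub {X : GroupLieAlgebra 𝓘(ℝ, EG) G} {c : ℝ → G}
    (hc : IsOneParameterSubgroup X c) (s t : ℝ) : c s * c (t - s) = c t := by
  rw [← hc.map_add, add_sub_cancel]

theorem Ad_one (X : GroupLieAlgebra 𝓘(ℝ, EG) G) : Ad (1 : G) X = X := by
  have h : (fun g : G => 1 * g * 1⁻¹) = id := by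
    ext g
    simp
  rw [Ad, h]
  exact congrArg (fun L : EG →L[ℝ] EG => L X) (mfderiv_id (I := 𝓘(ℝ, EG)) (x := (1 : G)))

theorem IsOneParameterSubgroup.hasMFDerivAt_sub {X : GroupLieAlgebra 𝓘(ℝ, EG) G} {c : ℝ → G}
    (hc : IsOneParameterSubgroup X c) (t : ℝ) :
    HasMFDerivAt 𝓘(ℝ, ℝ) 𝓘(ℝ, EG) (fun s => c (s - t)) t
      (mfderiv 𝓘(ℝ, ℝ) 𝓘(ℝ, EG) c 0 : ℝ →L[ℝ] EG) := by
  have h2 : ∀ r : ℝ, r = 0 → HasMFDerivAt 𝓘(ℝ, ℝ) 𝓘(ℝ, EG) c r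
      (mfderiv 𝓘(ℝ, ℝ) 𝓘(ℝ, EG) c 0 : ℝ →L[ℝ] EG) := by
    rintro _ rfl
    exact (hc.smooth.contMDiffAt.mdifferentiableAt (by simp)).hasMFDerivAt
  have h3 : HasMFDerivAt 𝓘(ℝ, ℝ) 𝓘(ℝ, ℝ) (fun s : ℝ => s - t) t (ContinuousLinearMap.id ℝ ℝ) :=
    ((hasFDerivAt_id t).sub_const t).hasMFDerivAt
  exact HasMFDerivAt.comp (f := fun s : ℝ => s - t) t (h2 (t - t) (sub_self t)) h3

variable [LieGroup 𝓘(ℝ, EG) ∞ G] [IsManifold 𝓘(ℝ, E) ∞ (G ⧸ H)]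

theorem contMDiffAt_extChartAt_of_mem {q x : G ⧸ H} (hx : x ∈ (extChartAt 𝓘(ℝ, E) q).source) :
    ContMDiffAt 𝓘(ℝ, E) 𝓘(ℝ, E) ∞ (extChartAt 𝓘(ℝ, E) q) x :=
  contMDiffAt_extChartAt' (by rwa [extChartAt_source] at hx)

theorem contMDiffAt_extChartAt_mk_mul
    (hπ : ContMDiff 𝓘(ℝ, EG) 𝓘(ℝ, E) ∞ (QuotientGroup.mk : G → G ⧸ H)) {q : G ⧸ H} {g k : G}
    (h : (QuotientGroup.mk (g * k) : G ⧸ H) ∈ (extChartAt 𝓘(ℝ, E) q).source) :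
    ContMDiffAt 𝓘(ℝ, EG) 𝓘(ℝ, E) ∞
      (fun k : G => extChartAt 𝓘(ℝ, E) q (QuotientGroup.mk (g * k) : G ⧸ H)) k :=
  (contMDiffAt_extChartAt_of_mem h).comp k
    (hπ.contMDiffAt.comp k (contMDiff_mul_left (I := 𝓘(ℝ, EG)) (n := ∞) (a := g)).contMDiffAt)

/-- `orbitDeriv` gives the velocities of the curves `t ↦ g θ(t) H`. -/
theorem hasDerivAt_extChartAt_mk_mul
    (hπ : ContMDiff 𝓘(ℝ, EG) 𝓘(ℝ, E) ∞ (QuotientGroup.mk : G → G ⧸ H)) {q : G ⧸ H} {g : G}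
    (h : (QuotientGroup.mk g : G ⧸ H) ∈ (extChartAt 𝓘(ℝ, E) q).source) {θ : ℝ → G} {t : ℝ}
    (hθ : MDifferentiableAt 𝓘(ℝ, ℝ) 𝓘(ℝ, EG) θ t) (h1 : θ t = 1) :
    HasDerivAt (fun s => extChartAt 𝓘(ℝ, E) q (QuotientGroup.mk (g * θ s) : G ⧸ H))
      (orbitDeriv EG E q g (mfderiv 𝓘(ℝ, ℝ) 𝓘(ℝ, EG) θ t (1 : ℝ) : EG)) t := by
  have h2 : ∀ k : G, k = 1 → HasMFDerivAt 𝓘(ℝ, EG) 𝓘(ℝ, E)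
      (fun k : G => extChartAt 𝓘(ℝ, E) q (QuotientGroup.mk (g * k) : G ⧸ H)) k
      (orbitDeriv EG E q g : EG →L[ℝ] E) := by
    rintro _ rfl
    exact ((contMDiffAt_extChartAt_mk_mul hπ (by rwa [mul_one])).mdifferentiableAt
      (by simp)).hasMFDerivAt
  have h3 := (h2 _ h1).comp t hθ.hasMFDerivAt
  exact hasDerivAt_of_hasMFDerivAt h3

theorem hasMFDerivAt_conj {θ : ℝ → G} {t : ℝ} (hθ : MDifferentiableAt 𝓘(ℝ, ℝ) 𝓘(ℝ, EG) θ t)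
    (h1 : θ t = 1) (k : G) :
    HasMFDerivAt 𝓘(ℝ, ℝ) 𝓘(ℝ, EG) (fun s => k * θ s * k⁻¹) t
      ((mfderiv 𝓘(ℝ, EG) 𝓘(ℝ, EG) (fun g : G => k * g * k⁻¹) 1 : EG →L[ℝ] EG).comp
        (mfderiv 𝓘(ℝ, ℝ) 𝓘(ℝ, EG) θ t : ℝ →L[ℝ] EG)) := by
  have h2 : ∀ g : G, g = 1 → HasMFDerivAt 𝓘(ℝ, EG) 𝓘(ℝ, EG) (fun g : G => k * g * k⁻¹) g
      (mfderiv 𝓘(ℝ, EG) 𝓘(ℝ, EG) (fun g : G => k * g * k⁻¹) 1 : EG →L[ℝ] EG) := by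
    rintro _ rfl
    have h : ContMDiffAt 𝓘(ℝ, EG) 𝓘(ℝ, EG) ∞ (fun g : G => k * g * k⁻¹) 1 :=
      (contMDiffAt_const.mul contMDiffAt_id).mul contMDiffAt_const
    exact (h.mdifferentiableAt (by simp)).hasMFDerivAt
  exact (h2 _ h1).comp t hθ.hasMFDerivAt

/-- The velocity of the curve `s ↦ b c(s) k H` for a one-parameter subgroup `c`. -/
theorem IsOneParameterSubgroup.hasDerivAt_extChartAt_mk
    {X : GroupLieAlgebra 𝓘(ℝ, EG) G} {c : ℝ → G} (hc : IsOneParameterSubgroup X c)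
    (hπ : ContMDiff 𝓘(ℝ, EG) 𝓘(ℝ, E) ∞ (QuotientGroup.mk : G → G ⧸ H)) {q : G ⧸ H} {b k : G}
    {s : ℝ}
    (h : (QuotientGroup.mk (b * c s * k) : G ⧸ H) ∈ (extChartAt 𝓘(ℝ, E) q).source) :
    HasDerivAt (fun s => extChartAt 𝓘(ℝ, E) q (QuotientGroup.mk (b * c s * k) : G ⧸ H))
      (orbitDeriv EG E q (b * c s * k) (Ad k⁻¹ X : EG)) s := by
  have h1 := hc.hasMFDerivAt_sub s
  have h0 : c (s - s) = 1 := by rw [sub_self, hc.map_zero]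
  have h2 := hasMFDerivAt_conj h1.mdifferentiableAt h0 k⁻¹
  have h3 := hasDerivAt_extChartAt_mk_mul hπ h h2.mdifferentiableAt (by rw [h0]; group)
  have h4 : (mfderiv 𝓘(ℝ, ℝ) 𝓘(ℝ, EG) (fun r => k⁻¹ * c (r - s) * k⁻¹⁻¹) s (1 : ℝ) : EG)
      = Ad k⁻¹ X := by
    refine (congrArg (fun L : ℝ →L[ℝ] EG => L 1) h2.mfderiv).trans ?_
    have h5 : (mfderiv 𝓘(ℝ, ℝ) 𝓘(ℝ, EG) (fun r => c (r - s)) s : ℝ →L[ℝ] EG) 1 = X :=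
      (congrArg (fun L : ℝ →L[ℝ] EG => L 1) h1.mfderiv).trans hc.velocity
    exact congrArg (fun v : EG =>
      (mfderiv 𝓘(ℝ, EG) 𝓘(ℝ, EG) (fun g : G => k⁻¹ * g * k⁻¹⁻¹) 1 : EG →L[ℝ] EG) v) h5
  rw [h4] at h3
  refine h3.congr_of_eventuallyEq (Eventually.of_forall fun r => ?_)
  -- Moving `k` to the left past the subgroup makes the curve a translate of one through `1` with
  -- velocity `Ad(k⁻¹) X`.
  have h6 : b * c r * k = b * c s * k * (k⁻¹ * c (r - s) * k⁻¹⁻¹) := by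
    rw [← hc.mul_sub s r]
    group
  simp only
  rw [h6]

theorem IsOneParameterSubgroup.hasDerivAt_extChartAt_mk_mul
    {X : GroupLieAlgebra 𝓘(ℝ, EG) G} {c : ℝ → G} (hc : IsOneParameterSubgroup X c)
    (hπ : ContMDiff 𝓘(ℝ, EG) 𝓘(ℝ, E) ∞ (QuotientGroup.mk : G → G ⧸ H)) {q : G ⧸ H} {b : G}
    {s : ℝ} (h : (QuotientGroup.mk (b * c s) : G ⧸ H) ∈ (extChartAt 𝓘(ℝ, E) q).source) :
    HasDerivAt (fun s => extChartAt 𝓘(ℝ, E) q (QuotientGroup.mk (b * c s) : G ⧸ H))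
      (orbitDeriv EG E q (b * c s) (X : EG)) s := by
  have h1 := hc.hasDerivAt_extChartAt_mk hπ (k := 1) (by rwa [mul_one])
  simp only [inv_one, mul_one, Ad_one] at h1
  exact h1

/-- Lift the coordinate line in the direction `w` through a local section of the projection sending
`gH` to `g`, and translate the lift back to `1` by `g⁻¹`; its initial velocity is a preimage of `w`.
-/
theorem orbitDeriv_surjective
    (hπ : Manifold.IsSubmersion 𝓘(ℝ, EG) 𝓘(ℝ, E) ∞ (QuotientGroup.mk : G → G ⧸ H))
    {q : G ⧸ H} {g : G} (h : (QuotientGroup.mk g : G ⧸ H) ∈ (extChartAt 𝓘(ℝ, E) q).source) :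
    Function.Surjective (orbitDeriv EG E q g : EG →L[ℝ] E) := by
  intro w
  obtain ⟨σ, hσ, hσd, hσe⟩ := exists_local_section (hπ.isSubmersionAt g)
  set φ := extChartAt 𝓘(ℝ, E) q with hφ
  set x := φ (QuotientGroup.mk g : G ⧸ H) with hx
  have hxs : φ.symm (x + (0 : ℝ) • w) = (QuotientGroup.mk g : G ⧸ H) := by
    rw [zero_smul, add_zero, hx, φ.left_inv h]
  have htar : (x + (0 : ℝ) • w) ∈ φ.target := by
    rw [zero_smul, add_zero]
    exact φ.map_source h
  have hline : ContMDiffAt 𝓘(ℝ, ℝ) 𝓘(ℝ, E) ∞ (fun s : ℝ => x + s • w) 0 := by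
    have : ContDiff ℝ ∞ (fun s : ℝ => x + s • w) := by fun_prop
    exact this.contMDiff.contMDiffAt
  have hopen : IsOpen φ.target := isOpen_extChartAt_target q
  have hsymm : ContMDiffAt 𝓘(ℝ, E) 𝓘(ℝ, E) ∞ φ.symm (x + (0 : ℝ) • w) :=
    (contMDiffOn_extChartAt_symm (I := 𝓘(ℝ, E)) (n := ∞) q).contMDiffAt (hopen.mem_nhds htar)
  have hcurve : ContMDiffAt 𝓘(ℝ, ℝ) 𝓘(ℝ, E) ∞ (fun s : ℝ => φ.symm (x + s • w)) 0 :=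
    hsymm.comp (0 : ℝ) hline
  have hσd' : ∀ y, y = (QuotientGroup.mk g : G ⧸ H) → MDifferentiableAt 𝓘(ℝ, E) 𝓘(ℝ, EG) σ y := by
    rintro _ rfl
    exact hσd
  have hlift : MDifferentiableAt 𝓘(ℝ, ℝ) 𝓘(ℝ, EG) (fun s : ℝ => σ (φ.symm (x + s • w))) 0 :=
    (hσd' _ hxs).comp (0 : ℝ) (hcurve.mdifferentiableAt (by simp))
  have hθ : MDifferentiableAt 𝓘(ℝ, ℝ) 𝓘(ℝ, EG)
      (fun s : ℝ => g⁻¹ * σ (φ.symm (x + s • w))) 0 :=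
    ((contMDiff_mul_left (I := 𝓘(ℝ, EG)) (n := ∞) (a := g⁻¹)).contMDiffAt.mdifferentiableAt
      (by simp)).comp (0 : ℝ) hlift
  have h1 := FinslerHomogeneous.hasDerivAt_extChartAt_mk_mul hπ.contMDiff h hθ (by
    rw [hxs, hσ, inv_mul_cancel])
  refine ⟨_, h1.unique ?_⟩
  have h2 : HasDerivAt (fun s : ℝ => x + s • w) w 0 := by
    simpa using ((hasDerivAt_id (0 : ℝ)).smul_const w).const_add x
  refine h2.congr_of_eventuallyEq ?_
  have h3 : ∀ᶠ s in 𝓝 (0 : ℝ), (QuotientGroup.mk (σ (φ.symm (x + s • w))) : G ⧸ H)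
      = φ.symm (x + s • w) := by
    rw [← hxs] at hσe
    exact hcurve.continuousAt.eventually hσe
  have h4 : ∀ᶠ s in 𝓝 (0 : ℝ), x + s • w ∈ φ.target :=
    hline.continuousAt.eventually (hopen.mem_nhds htar)
  filter_upwards [h3, h4] with s hs3 hs4
  rw [mul_inv_cancel_left, hs3, φ.right_inv hs4]

variable {F : TangentBundle 𝓘(ℝ, E) (G ⧸ H) → ℝ}

/-- Invariance of `F`: all the maps `orbitDeriv EG E q g` are isometric. -/
theorem IsInvariant.localF_orbitDeriv (hinv : IsInvariant H F)
    (hπ : ContMDiff 𝓘(ℝ, EG) 𝓘(ℝ, E) ∞ (QuotientGroup.mk : G → G ⧸ H)) {q : G ⧸ H} {g : G}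
    (h : (QuotientGroup.mk g : G ⧸ H) ∈ (extChartAt 𝓘(ℝ, E) q).source)
    (W : GroupLieAlgebra 𝓘(ℝ, EG) G) :
    localF F q (extChartAt 𝓘(ℝ, E) q (QuotientGroup.mk g : G ⧸ H)) (orbitDeriv EG E q g (W : EG))
      = normAtOrigin H F W := by
  have hopen : IsOpen (extChartAt 𝓘(ℝ, E) q).target := isOpen_extChartAt_target q
  have key : ∀ x : E, extChartAt 𝓘(ℝ, E) q (QuotientGroup.mk (g * 1) : G ⧸ H) = x →
      localF F q x (orbitDeriv EG E q g (W : EG)) = normAtOrigin H F W := by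
    rintro _ rfl
    have h' : (QuotientGroup.mk (g * 1) : G ⧸ H) ∈ (extChartAt 𝓘(ℝ, E) q).source := by
      rwa [mul_one]
    have hd := (contMDiffAt_extChartAt_mk_mul hπ h').mdifferentiableAt (by simp)
    have hs : MDifferentiableAt 𝓘(ℝ, E) 𝓘(ℝ, E) (extChartAt 𝓘(ℝ, E) q).symm
        (extChartAt 𝓘(ℝ, E) q (QuotientGroup.mk (g * 1) : G ⧸ H)) :=
      ((contMDiffOn_extChartAt_symm (I := 𝓘(ℝ, E)) (n := ∞) q).contMDiffAt
        (hopen.mem_nhds ((extChartAt 𝓘(ℝ, E) q).map_source h'))).mdifferentiableAt (by simp)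
    -- The map `k ↦ g k H` factors near `1` through the chart, and also as the projection followed
    -- by the isometry `g`. Comparing the two tangent maps gives the equality of norms.
    have e1 := tangentMap_comp_at (I := 𝓘(ℝ, EG)) (I' := 𝓘(ℝ, E)) (I'' := 𝓘(ℝ, E))
      (⟨1, W⟩ : TangentBundle 𝓘(ℝ, EG) G) hs hd
    have e2 : tangentMap 𝓘(ℝ, EG) 𝓘(ℝ, E) ((extChartAt 𝓘(ℝ, E) q).symm ∘
        fun k : G => extChartAt 𝓘(ℝ, E) q (QuotientGroup.mk (g * k) : G ⧸ H))
          (⟨1, W⟩ : TangentBundle 𝓘(ℝ, EG) G)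
        = tangentMap 𝓘(ℝ, EG) 𝓘(ℝ, E) ((fun y : G ⧸ H => g • y) ∘ QuotientGroup.mk)
          (⟨1, W⟩ : TangentBundle 𝓘(ℝ, EG) G) := by
      refine tangentMap_eq_of_eventuallyEq ?_
      have hc : ContinuousAt (fun k : G => (QuotientGroup.mk (g * k) : G ⧸ H)) 1 :=
        (hπ.contMDiffAt.comp (1 : G)
          (contMDiff_mul_left (I := 𝓘(ℝ, EG)) (n := ∞) (a := g)).contMDiffAt).continuousAt
      filter_upwards [hc.eventually ((isOpen_extChartAt_source q).mem_nhds h')] with k hk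
      exact (extChartAt 𝓘(ℝ, E) q).left_inv hk
    have e3 := tangentMap_comp_at (I := 𝓘(ℝ, EG)) (I' := 𝓘(ℝ, E)) (I'' := 𝓘(ℝ, E))
      (f := (QuotientGroup.mk : G → G ⧸ H)) (g := fun y : G ⧸ H => g • y)
      (⟨1, W⟩ : TangentBundle 𝓘(ℝ, EG) G)
      ((hinv g).smooth.contMDiffAt.mdifferentiableAt (by simp))
      (hπ.contMDiffAt.mdifferentiableAt (by simp))
    have e4 := (hinv g).preserves (tangentMap 𝓘(ℝ, EG) 𝓘(ℝ, E) (QuotientGroup.mk : G → G ⧸ H)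
      (⟨1, W⟩ : TangentBundle 𝓘(ℝ, EG) G))
    have e5 := congrArg F ((e1.symm.trans e2).trans e3)
    exact e5.trans e4
  exact key _ (by rw [mul_one])

end Orbit

theorem hasDerivAt_comp_of_hasFDerivAt {V : Type*} [NormedAddCommGroup V] [NormedSpace ℝ V]
    {Φ : V → ℝ} {D : V →L[ℝ] ℝ} {f : ℝ → V} {v x : V} (hΦ : HasFDerivAt Φ D x)
    (hf : HasDerivAt f v 0) (hx : f 0 = x) : HasDerivAt (fun r => Φ (f r)) (D v) 0 := by
  subst hx
  exact hΦ.comp_hasDerivAt (0 : ℝ) hf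

theorem apply_eq_zero_of_comp_const {V : Type*} [NormedAddCommGroup V] [NormedSpace ℝ V]
    {Φ : V → ℝ} {D : V →L[ℝ] ℝ} {f : ℝ → V} {v x : V} {C : ℝ} (hΦ : HasFDerivAt Φ D x)
    (hf : HasDerivAt f v 0) (hx : f 0 = x) (hC : ∀ r, Φ (f r) = C) : D v = 0 :=
  (hasDerivAt_comp_of_hasFDerivAt hΦ hf hx).unique
    ((hasDerivAt_const (0 : ℝ) C).congr_of_eventuallyEq (Eventually.of_forall hC))

/-! ### The pulled back norm on `𝔤` and its infinitesimal invariance. -/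

section OriginNorm

variable {EG : Type*} [NormedAddCommGroup EG] [NormedSpace ℝ EG]
  {G : Type*} [TopologicalSpace G] [ChartedSpace EG G] [Group G]
  {H : Subgroup G}
  {E : Type*} [NormedAddCommGroup E] [NormedSpace ℝ E] [ChartedSpace E (G ⧸ H)]
  [IsManifold 𝓘(ℝ, E) ∞ (G ⧸ H)]
  {F : TangentBundle 𝓘(ℝ, E) (G ⧸ H) → ℝ}

variable (EG H F) in
/-- The pulled back Minkowski norm, on the model space of `G`. -/
noncomputable def originNorm (X : EG) : ℝ :=
  normAtOrigin H F (X : GroupLieAlgebra 𝓘(ℝ, EG) G)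

theorem originNorm_smul (hF : IsFinslerMetric F) (X : EG) (t : ℝ) (ht : 0 ≤ t) :
    originNorm EG H F (t • X) = t * originNorm EG H F X := by
  have h := hF.homogeneous (QuotientGroup.mk 1 : G ⧸ H)
    (dproj H (X : GroupLieAlgebra 𝓘(ℝ, EG) G)) t ht
  have h2 : dproj H ((t • X : EG) : GroupLieAlgebra 𝓘(ℝ, EG) G)
      = t • dproj H (X : GroupLieAlgebra 𝓘(ℝ, EG) G) :=
    (dproj (EG := EG) (E := E) H).map_smul t X
  exact (congrArg (fiber F (QuotientGroup.mk 1 : G ⧸ H)) h2).trans h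

variable [LieGroup 𝓘(ℝ, EG) ∞ G]

/-- `F` is definite and `orbitDeriv` preserves norms, so the kernel of `orbitDeriv` is the null set
of `originNorm`, whatever `q` and `g` are. -/
theorem orbitDeriv_eq_zero_iff
    (hF : IsFinslerMetric F) (hinv : IsInvariant H F)
    (hπ : ContMDiff 𝓘(ℝ, EG) 𝓘(ℝ, E) ∞ (QuotientGroup.mk : G → G ⧸ H))
    {q : G ⧸ H} {g : G}
    (h : (QuotientGroup.mk g : G ⧸ H) ∈ (extChartAt 𝓘(ℝ, E) q).source) (X : EG) :
    orbitDeriv EG E q g X = 0 ↔ originNorm EG H F X = 0 := by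
  rw [← hF.localF_eq_zero_iff ((extChartAt 𝓘(ℝ, E) q).map_source h),
    hinv.localF_orbitDeriv hπ h X]
  rfl

theorem originNorm_add_of_eq_zero
    (hF : IsFinslerMetric F) (hinv : IsInvariant H F)
    (hπ : ContMDiff 𝓘(ℝ, EG) 𝓘(ℝ, E) ∞ (QuotientGroup.mk : G → G ⧸ H))
    (X : EG) {V : EG} (hV : originNorm EG H F V = 0) :
    originNorm EG H F (X + V) = originNorm EG H F X := by
  have h := mem_extChartAt_source (I := 𝓘(ℝ, E)) (QuotientGroup.mk 1 : G ⧸ H)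
  have h1 := hinv.localF_orbitDeriv hπ h (X + V : EG)
  have h2 := hinv.localF_orbitDeriv hπ h X
  have h3 : orbitDeriv EG E (QuotientGroup.mk 1 : G ⧸ H) (1 : G) (X + V)
      = orbitDeriv EG E (QuotientGroup.mk 1 : G ⧸ H) (1 : G) X := by
    rw [map_add, (orbitDeriv_eq_zero_iff hF hinv hπ h V).2 hV, add_zero]
  rw [h3] at h1
  exact h1.symm.trans h2

theorem contDiffAt_originNorm_sq
    (hF : IsFinslerMetric F) (hinv : IsInvariant H F)
    (hπ : ContMDiff 𝓘(ℝ, EG) 𝓘(ℝ, E) ∞ (QuotientGroup.mk : G → G ⧸ H))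
    {X : EG} (hX : originNorm EG H F X ≠ 0) :
    ContDiffAt ℝ ∞ (fun Y : EG => originNorm EG H F Y ^ 2) X := by
  have h := mem_extChartAt_source (I := 𝓘(ℝ, E)) (QuotientGroup.mk 1 : G ⧸ H)
  have h1 := (hF.contDiffAt_localF_sq ((extChartAt 𝓘(ℝ, E) _).map_source h)
    (mt (orbitDeriv_eq_zero_iff hF hinv hπ h X).1 hX)).comp X
      (orbitDeriv EG E (QuotientGroup.mk 1 : G ⧸ H) (1 : G)).contDiff.contDiffAt
  refine h1.congr_of_eventuallyEq (Eventually.of_forall fun Y => ?_)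
  exact congrArg (· ^ 2) (hinv.localF_orbitDeriv hπ h Y).symm

theorem fderiv_originNorm_sq_eq_zero
    (hF : IsFinslerMetric F) (hinv : IsInvariant H F)
    (hπ : ContMDiff 𝓘(ℝ, EG) 𝓘(ℝ, E) ∞ (QuotientGroup.mk : G → G ⧸ H))
    {X V : EG} (hX : originNorm EG H F X ≠ 0)
    (hV : originNorm EG H F V = 0) : fderiv ℝ (fun Y : EG => originNorm EG H F Y ^ 2) X V = 0 := by
  have h := mem_extChartAt_source (I := 𝓘(ℝ, E)) (QuotientGroup.mk 1 : G ⧸ H)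
  have h1 : HasDerivAt (fun t : ℝ => X + t • V) V 0 := by
    simpa using ((hasDerivAt_id (0 : ℝ)).smul_const V).const_add X
  refine apply_eq_zero_of_comp_const
    ((contDiffAt_originNorm_sq hF hinv hπ hX).differentiableAt (by simp)).hasFDerivAt h1
    (by rw [zero_smul, add_zero]) (C := originNorm EG H F X ^ 2) fun t => ?_
  refine congrArg (· ^ 2) (originNorm_add_of_eq_zero hF hinv hπ X ?_)
  rw [← orbitDeriv_eq_zero_iff hF hinv hπ h, map_smul,
    (orbitDeriv_eq_zero_iff hF hinv hπ h V).2 hV, smul_zero]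

/-- A one-parameter subgroup of `H` projects to a constant curve, so its generator is killed by
`dπ`. -/
theorem originNorm_eq_zero_of_memLieAlgebra
    (hF : IsFinslerMetric F) (hinv : IsInvariant H F)
    (hπ : ContMDiff 𝓘(ℝ, EG) 𝓘(ℝ, E) ∞ (QuotientGroup.mk : G → G ⧸ H))
    {V : GroupLieAlgebra 𝓘(ℝ, EG) G}
    (hV : MemLieAlgebra H V) : originNorm EG H F (V : EG) = 0 := by
  obtain ⟨c, hc, hcH⟩ := hV
  have h := mem_extChartAt_source (I := 𝓘(ℝ, E)) (QuotientGroup.mk 1 : G ⧸ H)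
  have hc0 : (1 : G) * c 0 = 1 := by rw [hc.map_zero, mul_one]
  have h1 := hc.hasDerivAt_extChartAt_mk_mul hπ (q := (QuotientGroup.mk 1 : G ⧸ H)) (b := 1)
    (s := 0) (by rwa [hc0])
  rw [hc0] at h1
  refine (orbitDeriv_eq_zero_iff hF hinv hπ h _).1 (h1.unique ?_)
  have h2 : ∀ s, (QuotientGroup.mk (1 * c s) : G ⧸ H) = QuotientGroup.mk 1 := fun s =>
    QuotientGroup.mk_mul_of_mem 1 (hcH s)
  simp only [h2]
  exact hasDerivAt_const _ _

/-- The curves `c(s) a H` and `c(s) H` coincide for `a ∈ H`. Their velocities are the images of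
`Ad(a⁻¹) X` at `a` and of `X` at `1`, and both images are isometric. -/
theorem originNorm_Ad_inv
    (hinv : IsInvariant H F)
    (hπ : ContMDiff 𝓘(ℝ, EG) 𝓘(ℝ, E) ∞ (QuotientGroup.mk : G → G ⧸ H))
    [FiniteDimensional ℝ EG] [T2Space G] {a : G} (ha : a ∈ H)
    (X : GroupLieAlgebra 𝓘(ℝ, EG) G) :
    originNorm EG H F (Ad a⁻¹ X : EG) = originNorm EG H F (X : EG) := by
  obtain ⟨c, hc⟩ := exists_isOneParameterSubgroup X
  have h := mem_extChartAt_source (I := 𝓘(ℝ, E)) (QuotientGroup.mk 1 : G ⧸ H)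
  have e1 : ∀ s, (QuotientGroup.mk (1 * c s * a) : G ⧸ H) = QuotientGroup.mk (1 * c s) := fun s =>
    QuotientGroup.mk_mul_of_mem _ ha
  have hc0 : (1 : G) * c 0 = 1 := by rw [hc.map_zero, mul_one]
  have ha1 : (QuotientGroup.mk a : G ⧸ H) = QuotientGroup.mk 1 := by
    rw [← QuotientGroup.mk_mul_of_mem (1 : G) ha, one_mul]
  have h1 := hc.hasDerivAt_extChartAt_mk_mul hπ (q := (QuotientGroup.mk 1 : G ⧸ H)) (b := 1)
    (s := 0) (by rwa [hc0])
  have h2 := hc.hasDerivAt_extChartAt_mk hπ (q := (QuotientGroup.mk 1 : G ⧸ H)) (b := 1)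
    (k := a) (s := 0) (by rwa [e1, hc0])
  simp only [e1] at h2
  have h3 := h2.unique h1
  rw [hc0, one_mul] at h3
  have h4 := hinv.localF_orbitDeriv hπ (g := a) (q := (QuotientGroup.mk 1 : G ⧸ H))
    (by rwa [ha1]) (Ad a⁻¹ X)
  have h5 := hinv.localF_orbitDeriv hπ h X
  rw [h3, ha1] at h4
  exact h4.symm.trans h5

/-- Natural reductivity makes the norm stationary along adjoint orbits through `m`. -/
theorem IsNaturallyReductive.fderiv_originNorm_bracket
    (hF : IsFinslerMetric F) (hinv : IsInvariant H F)
    (hπ : ContMDiff 𝓘(ℝ, EG) 𝓘(ℝ, E) ∞ (QuotientGroup.mk : G → G ⧸ H))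
    [FiniteDimensional ℝ EG] [T2Space G]
    {h m : Submodule ℝ (GroupLieAlgebra 𝓘(ℝ, EG) G)} {hm : IsCompl m h}
    (hh : ∀ X, X ∈ h ↔ MemLieAlgebra H X)
    (hnr : ∀ x ∈ m, ∀ y ∈ m, ∀ u ∈ m, ∀ v ∈ m, y ≠ 0 →
      fundamentalForm (normAtOrigin H F) y (m.projection h hm ⁅x, u⁆) v
        + fundamentalForm (normAtOrigin H F) y u (m.projection h hm ⁅x, v⁆)
        + 2 * cartanForm (normAtOrigin H F) y (m.projection h hm ⁅x, y⁆) u v = 0)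
    {X : GroupLieAlgebra 𝓘(ℝ, EG) G} (hX : X ∈ m) (hX0 : originNorm EG H F (X : EG) ≠ 0)
    (Z : GroupLieAlgebra 𝓘(ℝ, EG) G) :
    fderiv ℝ (fun Y : EG => originNorm EG H F Y ^ 2) (X : EG)
      (⁅X, Z⁆ : GroupLieAlgebra 𝓘(ℝ, EG) G) = 0 := by
  have : LieGroup 𝓘(ℝ, EG) (minSmoothness ℝ 3) G := lieGroup_minSmoothness
  have : CompleteSpace EG := FiniteDimensional.complete ℝ EG
  set D : EG →L[ℝ] ℝ := fderiv ℝ (fun Y : EG => originNorm EG H F Y ^ 2) (X : EG) with hD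
  have hsm := contDiffAt_originNorm_sq hF hinv hπ hX0
  have hdiff : HasFDerivAt (fun Y : EG => originNorm EG H F Y ^ 2) D (X : EG) :=
    (hsm.differentiableAt (by simp)).hasFDerivAt
  have hDh : ∀ V ∈ h, D (V : EG) = 0 := by
    intro V hV
    exact fderiv_originNorm_sq_eq_zero hF hinv hπ hX0
      (originNorm_eq_zero_of_memLieAlgebra hF hinv hπ ((hh V).1 hV))
  -- For `Z ∈ 𝔥` the norm is constant along `Ad(exp(-rZ)) X`, whose velocity at `r = 0` is `[X, Z]`.
  have hZh : ∀ Z ∈ h, D (⁅X, Z⁆ : GroupLieAlgebra 𝓘(ℝ, EG) G) = 0 := by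
    intro Z hZ
    obtain ⟨c, hc, hcH⟩ := (hh Z).1 hZ
    have h1 := hc.hasDerivAt_Ad_inv X
    have e : (Ad (c 0)⁻¹ X : EG) = X := by
      rw [hc.map_zero, inv_one]
      exact Ad_one X
    exact apply_eq_zero_of_comp_const hdiff h1 e
      fun r => congrArg (· ^ 2) (originNorm_Ad_inv hinv hπ (hcH r) X)
  have hXne : X ≠ 0 := by
    rintro rfl
    refine hX0 ?_
    have := originNorm_smul (EG := EG) (H := H) hF (0 : EG) 0 le_rfl
    rw [zero_smul, zero_mul] at this
    exact this
  have hZm : ∀ Z ∈ m, D (⁅X, Z⁆ : GroupLieAlgebra 𝓘(ℝ, EG) G) = 0 := by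
    intro Z hZ
    have hsm2 : ContDiffAt ℝ 2 (fun Y : EG => originNorm EG H F Y ^ 2) (X : EG) :=
      hsm.of_le (one_add_one_eq_two (R := WithTop ℕ∞) ▸ two_le_infty)
    -- With `y = u = v = X` the Cartan term differentiates `g` along the ray of its own base point
    -- and drops out. The two remaining terms are equal by symmetry, so `g_X([Z, X]_𝔪, X) = 0`.
    have h1 := hnr Z hZ X hX X hX X hX hXne
    set P : GroupLieAlgebra 𝓘(ℝ, EG) G := m.projection h hm ⁅Z, X⁆ with hP
    have e1 : fundamentalForm (normAtOrigin H F) X P X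
        = fundamentalForm (normAtOrigin H F) X X P :=
      fundamentalForm_comm (φ := originNorm EG H F) hsm2 P X
    have e2 : fundamentalForm (normAtOrigin H F) X X P = 1 / 2 * D (P : EG) :=
      fundamentalForm_self_left (φ := originNorm EG H F) (originNorm_smul hF) hsm2 P
    have e3 : cartanForm (normAtOrigin H F) X P X X = 0 :=
      cartanForm_self_right (φ := originNorm EG H F) (originNorm_smul hF) (X : EG) P X
    rw [e3, e1, e2] at h1
    have h2 : D (P : EG) = 0 := by linarith
    have h3 : ⁅Z, X⁆ - P ∈ h := by
      rw [hP]
      have := Submodule.sub_projection_mem hm ⁅Z, X⁆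
      exact this
    have h4 := hDh _ h3
    have h5 : (⁅X, Z⁆ : GroupLieAlgebra 𝓘(ℝ, EG) G) = -((⁅Z, X⁆ - P) + P) := by
      rw [sub_add_cancel, lie_skew]
    rw [h5]
    have h6 : D (-((⁅Z, X⁆ - P) + P) : GroupLieAlgebra 𝓘(ℝ, EG) G)
        = -(D ((⁅Z, X⁆ - P : GroupLieAlgebra 𝓘(ℝ, EG) G) : EG) + D (P : EG)) :=
      (map_neg D _).trans (congrArg Neg.neg (map_add D _ _))
    rw [h6, h4, h2]
    simp
  obtain ⟨Z₁, hZ₁, Z₂, hZ₂, rfl⟩ : ∃ y ∈ m, ∃ z ∈ h, y + z = Z :=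
    Submodule.mem_sup.1 (by rw [hm.sup_eq_top]; trivial)
  rw [lie_add]
  refine (map_add D _ _).trans ?_
  rw [hZm _ hZ₁, hZh _ hZ₂, add_zero]

end OriginNorm

/-! ### Orbits with stationary norm are geodesics. -/

section OrbitGeodesic

variable {EG : Type*} [NormedAddCommGroup EG] [NormedSpace ℝ EG]
  {G : Type*} [TopologicalSpace G] [ChartedSpace EG G] [Group G] [LieGroup 𝓘(ℝ, EG) ∞ G]
  {H : Subgroup G}
  {E : Type*} [NormedAddCommGroup E] [NormedSpace ℝ E] [ChartedSpace E (G ⧸ H)]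
  [IsManifold 𝓘(ℝ, E) ∞ (G ⧸ H)]
  {F : TangentBundle 𝓘(ℝ, E) (G ⧸ H) → ℝ}

theorem contDiffAt_extChartAt_mk_mul_mul
    (hπ : ContMDiff 𝓘(ℝ, EG) 𝓘(ℝ, E) ∞ (QuotientGroup.mk : G → G ⧸ H)) {c e : ℝ → G}
    (hc : ContMDiff 𝓘(ℝ, ℝ) 𝓘(ℝ, EG) ∞ c) (he : ContMDiff 𝓘(ℝ, ℝ) 𝓘(ℝ, EG) ∞ e) {q : G ⧸ H}
    {a : G} {p : ℝ × ℝ}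
    (h : (QuotientGroup.mk (a * c p.2 * e p.1) : G ⧸ H) ∈ (extChartAt 𝓘(ℝ, E) q).source) :
    ContDiffAt ℝ ∞ (fun p : ℝ × ℝ =>
      extChartAt 𝓘(ℝ, E) q (QuotientGroup.mk (a * c p.2 * e p.1) : G ⧸ H)) p := by
  have h1 : ContMDiffAt 𝓘(ℝ, ℝ × ℝ) 𝓘(ℝ, EG) ∞ (fun p : ℝ × ℝ => c p.2) p :=
    hc.contMDiffAt.comp p contDiff_snd.contMDiff.contMDiffAt
  have h2 : ContMDiffAt 𝓘(ℝ, ℝ × ℝ) 𝓘(ℝ, EG) ∞ (fun p : ℝ × ℝ => e p.1) p :=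
    he.contMDiffAt.comp p contDiff_fst.contMDiff.contMDiffAt
  have h3 : ContMDiffAt 𝓘(ℝ, ℝ × ℝ) 𝓘(ℝ, EG) ∞ (fun p : ℝ × ℝ => a * c p.2 * e p.1) p :=
    (contMDiffAt_const.mul h1).mul h2
  exact ((contMDiffAt_extChartAt_of_mem h).comp p (hπ.contMDiffAt.comp p h3)).contDiffAt

/-- Differentiating the invariance of the norm in the velocity shows that the momentum along
translates of `Z` does not depend on `g`: this is the conserved quantity of the orbit. -/
theorem fderiv_energy_orbitDeriv (hF : IsFinslerMetric F) (hinv : IsInvariant H F)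
    (hπ : ContMDiff 𝓘(ℝ, EG) 𝓘(ℝ, E) ∞ (QuotientGroup.mk : G → G ⧸ H)) {q : G ⧸ H} {g : G}
    (h : (QuotientGroup.mk g : G ⧸ H) ∈ (extChartAt 𝓘(ℝ, E) q).source) {X : EG}
    (hX : originNorm EG H F X ≠ 0) (Z : EG) :
    fderiv ℝ (energy F q) (extChartAt 𝓘(ℝ, E) q (QuotientGroup.mk g : G ⧸ H),
        orbitDeriv EG E q g X) (0, orbitDeriv EG E q g Z)
      = fderiv ℝ (fun Y : EG => originNorm EG H F Y ^ 2) X Z := by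
  set x := extChartAt 𝓘(ℝ, E) q (QuotientGroup.mk g : G ⧸ H) with hx
  have h0 : orbitDeriv EG E q g X ≠ 0 := mt (orbitDeriv_eq_zero_iff hF hinv hπ h X).1 hX
  have h1 := ((hF.contDiffAt_energy ((extChartAt 𝓘(ℝ, E) q).map_source h) h0).differentiableAt
    (by simp)).hasFDerivAt
  have h2 : HasFDerivAt (fun Y : EG => (x, orbitDeriv EG E q g Y))
      (ContinuousLinearMap.prod 0 (orbitDeriv EG E q g : EG →L[ℝ] E)) X :=
    (hasFDerivAt_const x X).prodMk (orbitDeriv EG E q g : EG →L[ℝ] E).hasFDerivAt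
  have h3 := h1.comp (f := fun Y : EG => (x, orbitDeriv EG E q g Y)) X h2
  have h4 : energy F q ∘ (fun Y : EG => (x, orbitDeriv EG E q g Y))
      = fun Y : EG => originNorm EG H F Y ^ 2 :=
    funext fun Y => congrArg (· ^ 2) (hinv.localF_orbitDeriv hπ h Y)
  rw [h4] at h3
  rw [h3.fderiv]
  rfl

/-- If the norm is stationary at `X` along the adjoint orbit of `X`, then the orbits of `exp(tX)`
are geodesics. -/
theorem IsOneParameterSubgroup.isGeodesicOn_orbit [FiniteDimensional ℝ EG] [T2Space G]
    (hF : IsFinslerMetric F) (hinv : IsInvariant H F)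
    (hπ : Manifold.IsSubmersion 𝓘(ℝ, EG) 𝓘(ℝ, E) ∞ (QuotientGroup.mk : G → G ⧸ H))
    {X : GroupLieAlgebra 𝓘(ℝ, EG) G} {c : ℝ → G} (hc : IsOneParameterSubgroup X c)
    (hX : originNorm EG H F X ≠ 0)
    (hstat : ∀ Z : GroupLieAlgebra 𝓘(ℝ, EG) G,
      fderiv ℝ (fun Y : EG => originNorm EG H F Y ^ 2) X
        (⁅X, Z⁆ : GroupLieAlgebra 𝓘(ℝ, EG) G) = 0) (a : G) :
    IsGeodesicOn F univ (fun t => (QuotientGroup.mk (a * c t) : G ⧸ H)) := by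
  have hπc : ContMDiff 𝓘(ℝ, EG) 𝓘(ℝ, E) ∞ (QuotientGroup.mk : G → G ⧸ H) := hπ.contMDiff
  have hγ : ContMDiff 𝓘(ℝ, ℝ) 𝓘(ℝ, E) ∞ (fun t => (QuotientGroup.mk (a * c t) : G ⧸ H)) :=
    hπc.comp (contMDiff_const.mul hc.smooth)
  have hvel : ∀ (q : G ⧸ H) (t : ℝ),
      (QuotientGroup.mk (a * c t) : G ⧸ H) ∈ (extChartAt 𝓘(ℝ, E) q).source →
      deriv (fun s => extChartAt 𝓘(ℝ, E) q (QuotientGroup.mk (a * c s) : G ⧸ H)) t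
        = orbitDeriv EG E q (a * c t) X := fun q t h =>
    (hc.hasDerivAt_extChartAt_mk_mul hπc h).deriv
  refine ⟨ordConnected_univ, nontrivial_univ, hγ.contMDiffOn, fun t _ q h => ?_,
    fun t _ q h => ?_⟩
  · rw [derivWithin_univ, hvel q t h]
    exact mt (orbitDeriv_eq_zero_iff hF hinv hπc h X).1 hX
  · rw [derivWithin_univ, derivWithin_univ]
    have hv0 : orbitDeriv EG E q (a * c t) X ≠ 0 :=
      mt (orbitDeriv_eq_zero_iff hF hinv hπc h X).1 hX
    rw [hvel q t h, hF.geodesicEquation_iff ((extChartAt 𝓘(ℝ, E) q).map_source h) hv0]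
    intro w
    obtain ⟨Z, hZ⟩ := orbitDeriv_surjective hπ h w
    obtain ⟨e, he⟩ := exists_isOneParameterSubgroup (E := EG) (G := G) Z
    -- The variation multiplies on the right by `exp(rZ)`. The variation field along the orbit is
    -- then the left translate of the fixed vector `Z`, with value `w` at time `t`.
    set Ψ : ℝ × ℝ → E := fun p =>
      extChartAt 𝓘(ℝ, E) q (QuotientGroup.mk (a * c p.2 * e p.1) : G ⧸ H) with hΨ
    have hsrc : ∀ᶠ p : ℝ × ℝ in 𝓝 (0, t),
        (QuotientGroup.mk (a * c p.2 * e p.1) : G ⧸ H) ∈ (extChartAt 𝓘(ℝ, E) q).source := by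
      have hcont : Continuous
          (fun p : ℝ × ℝ => (QuotientGroup.mk (a * c p.2 * e p.1) : G ⧸ H)) := by
        have := topologicalGroup_of_lieGroup 𝓘(ℝ, EG) (G := G) ∞
        exact hπc.continuous.comp ((continuous_const.mul
          (hc.smooth.continuous.comp continuous_snd)).mul
            (he.smooth.continuous.comp continuous_fst))
      refine hcont.continuousAt.eventually ((isOpen_extChartAt_source q).mem_nhds ?_)
      simpa only [he.map_zero, mul_one] using h
    have hsm : ∀ {p : ℝ × ℝ},
        (QuotientGroup.mk (a * c p.2 * e p.1) : G ⧸ H) ∈ (extChartAt 𝓘(ℝ, E) q).source →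
        ContDiffAt ℝ ∞ Ψ p := fun hp =>
      contDiffAt_extChartAt_mk_mul_mul hπc hc.smooth he.smooth hp
    have hd : ∀ {p : ℝ × ℝ},
        (QuotientGroup.mk (a * c p.2 * e p.1) : G ⧸ H) ∈ (extChartAt 𝓘(ℝ, E) q).source →
        HasFDerivAt Ψ (fderiv ℝ Ψ p) p := fun hp =>
      ((hsm hp).differentiableAt (by simp)).hasFDerivAt
    have hds : ∀ {r s : ℝ},
        (QuotientGroup.mk (a * c s * e r) : G ⧸ H) ∈ (extChartAt 𝓘(ℝ, E) q).source →
        fderiv ℝ Ψ (r, s) (0, 1) = orbitDeriv EG E q (a * c s * e r) (Ad (e r)⁻¹ X : EG) := by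
      intro r s hp
      exact (hasFDerivAt_comp_right_line (hd (p := (r, s)) hp)).unique
        (hc.hasDerivAt_extChartAt_mk hπc hp)
    have he0 : ∀ s, a * c s * e 0 = a * c s := fun s => by rw [he.map_zero, mul_one]
    have hdr : ∀ {s : ℝ},
        (QuotientGroup.mk (a * c s) : G ⧸ H) ∈ (extChartAt 𝓘(ℝ, E) q).source →
        fderiv ℝ Ψ (0, s) (1, 0) = orbitDeriv EG E q (a * c s) Z := by
      intro s hp
      have h1 := he.hasDerivAt_extChartAt_mk_mul hπc (q := q) (b := a * c s) (s := 0) (by rwa [he0])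
      rw [he0] at h1
      exact (hasFDerivAt_comp_left_line (hd (p := (0, s)) (by simpa only [he0] using hp))).unique h1
    have hAd0 : (Ad (e 0)⁻¹ X : EG) = X := by
      rw [he.map_zero, inv_one]
      exact Ad_one X
    have hds0 : ∀ {s : ℝ},
        (QuotientGroup.mk (a * c s) : G ⧸ H) ∈ (extChartAt 𝓘(ℝ, E) q).source →
        fderiv ℝ Ψ (0, s) (0, 1) = orbitDeriv EG E q (a * c s) X := by
      intro s hp
      have h1 := hds (r := 0) (s := s) (by rwa [he0])
      rw [he0] at h1
      exact h1.trans (congrArg (orbitDeriv EG E q (a * c s)) hAd0)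
    have hΨ0 : ∀ s, Ψ (0, s) = extChartAt 𝓘(ℝ, E) q (QuotientGroup.mk (a * c s) : G ⧸ H) := by
      intro s
      rw [hΨ]
      simp only [he0]
    have ht0 : (QuotientGroup.mk (a * c t * e 0) : G ⧸ H) ∈ (extChartAt 𝓘(ℝ, E) q).source := by
      rwa [he0]
    have hsrcs : ∀ᶠ s in 𝓝 t,
        (QuotientGroup.mk (a * c s) : G ⧸ H) ∈ (extChartAt 𝓘(ℝ, E) q).source := by
      have h1 : Tendsto (fun s : ℝ => ((0 : ℝ), s)) (𝓝 t) (𝓝 (0, t)) :=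
        (Continuous.prodMk_right (0 : ℝ)).tendsto t
      filter_upwards [h1.eventually hsrc] with s hs
      simpa only [he0] using hs
    have hacc : deriv (deriv fun s => extChartAt 𝓘(ℝ, E) q (QuotientGroup.mk (a * c s) : G ⧸ H)) t
        = fderiv ℝ (fderiv ℝ Ψ) (0, t) (0, 1) (0, 1) := by
      have h1 : HasFDerivAt (fderiv ℝ Ψ) (fderiv ℝ (fderiv ℝ Ψ) (0, t)) ((0 : ℝ), t) :=
        (((hsm (p := (0, t)) ht0).fderiv_right (m := ∞) (by simp)).differentiableAt
          (by simp)).hasFDerivAt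
      have h2 : HasFDerivAt (fun p => fderiv ℝ Ψ p (0, 1))
          ((ContinuousLinearMap.apply ℝ E ((0, 1) : ℝ × ℝ)) ∘L fderiv ℝ (fderiv ℝ Ψ) (0, t))
          ((0 : ℝ), t) :=
        (ContinuousLinearMap.apply ℝ E ((0, 1) : ℝ × ℝ)).hasFDerivAt.comp ((0 : ℝ), t) h1
      have h3 := hasFDerivAt_comp_right_line h2
      refine (h3.congr_of_eventuallyEq ?_).deriv
      filter_upwards [hsrcs] with s hs
      rw [hvel q s hs, hds0 hs]
    have hlag : ContDiffAt ℝ ∞ (energy F q) (Ψ (0, t), fderiv ℝ Ψ (0, t) (0, 1)) := by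
      rw [hΨ0, hds0 h]
      exact hF.contDiffAt_energy ((extChartAt 𝓘(ℝ, E) q).map_source h) hv0
    -- The varied velocity is a translate of `Ad(exp(-rZ)) X`, so by invariance its energy is the
    -- squared origin norm of that vector, with derivative `d(φ²)_X [X, Z]` at `r = 0`.
    have hstat' : HasDerivAt (fun r => energy F q (Ψ (r, t), fderiv ℝ Ψ (r, t) (0, 1))) 0 0 := by
      have h1 := ((contDiffAt_originNorm_sq hF hinv hπc hX).differentiableAt
        (by simp)).hasFDerivAt
      have h2 := (hasDerivAt_comp_of_hasFDerivAt h1 (he.hasDerivAt_Ad_inv X) hAd0).congr_deriv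
        (hstat Z)
      refine h2.congr_of_eventuallyEq ?_
      have h3 : Tendsto (fun r : ℝ => (r, t)) (𝓝 0) (𝓝 (0, t)) :=
        (Continuous.prodMk_left t).tendsto 0
      filter_upwards [h3.eventually hsrc] with r hr
      rw [hds hr]
      exact congrArg (· ^ 2) (hinv.localF_orbitDeriv hπc hr (Ad (e r)⁻¹ X))
    have hcons : ∀ᶠ s in 𝓝 t, fderiv ℝ (energy F q) (Ψ (0, s), fderiv ℝ Ψ (0, s) (0, 1))
        (0, fderiv ℝ Ψ (0, s) (1, 0))
          = fderiv ℝ (fun Y : EG => originNorm EG H F Y ^ 2) X Z := by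
      filter_upwards [hsrcs] with s hs
      rw [hΨ0, hds0 hs, hdr hs]
      exact fderiv_energy_orbitDeriv hF hinv hπc hs hX Z
    have hEL := eulerLagrange_of_variation (hsm (p := (0, t)) ht0) hlag hstat' hcons
    rw [hΨ0, hds0 h, hdr h, hZ, ← hacc] at hEL
    exact hEL

end OrbitGeodesic

/-! ### Restriction of complete geodesics to intervals. -/

section Restriction

variable {E : Type*} [NormedAddCommGroup E] [NormedSpace ℝ E]
  {M : Type*} [TopologicalSpace M] [ChartedSpace E M] [IsManifold 𝓘(ℝ, E) ∞ M]
  {F : TangentBundle 𝓘(ℝ, E) M → ℝ}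

/-- A nondegenerate interval has unique derivatives, so for a curve smooth on all of `ℝ` the
derivatives within `J` are the ordinary ones, also at endpoints. -/
theorem IsGeodesicOn.restrict {γ : ℝ → M} (hγ : IsGeodesicOn F univ γ) {J : Set ℝ}
    (hJ : J.OrdConnected) (hJn : J.Nontrivial) : IsGeodesicOn F J γ := by
  have hu : UniqueDiffOn ℝ J := by
    refine uniqueDiffOn_convex hJ.convex ?_
    obtain ⟨a, ha, b, hb, hab⟩ := hJn.exists_lt
    refine (nonempty_Ioo.2 hab).mono (interior_maximal ?_ isOpen_Ioo)
    exact Ioo_subset_Icc_self.trans (hJ.out ha hb)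
  have hsm : ∀ {q : M} {t : ℝ}, γ t ∈ (extChartAt 𝓘(ℝ, E) q).source →
      ContDiffAt ℝ ∞ (fun s => extChartAt 𝓘(ℝ, E) q (γ s)) t := by
    intro q t h
    have h1 : ContMDiffAt 𝓘(ℝ, E) 𝓘(ℝ, E) ∞ (extChartAt 𝓘(ℝ, E) q) (γ t) :=
      contMDiffAt_extChartAt' (by rwa [extChartAt_source] at h)
    have h2 : ContMDiffAt 𝓘(ℝ, ℝ) 𝓘(ℝ, E) ∞ γ t := hγ.smooth.contMDiffAt univ_mem
    exact (h1.comp t h2).contDiffAt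
  have hcont : Continuous γ := continuousOn_univ.1 hγ.smooth.continuousOn
  have hev : ∀ {q : M} {t : ℝ}, γ t ∈ (extChartAt 𝓘(ℝ, E) q).source →
      ∀ᶠ s in 𝓝 t, γ s ∈ (extChartAt 𝓘(ℝ, E) q).source := fun h =>
    hcont.continuousAt.eventually ((isOpen_extChartAt_source _).mem_nhds h)
  have h1 : ∀ {q : M} {t : ℝ}, t ∈ J → γ t ∈ (extChartAt 𝓘(ℝ, E) q).source →
      derivWithin (fun s => extChartAt 𝓘(ℝ, E) q (γ s)) J t
        = deriv (fun s => extChartAt 𝓘(ℝ, E) q (γ s)) t := fun ht h =>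
    ((hsm h).differentiableAt (by simp)).derivWithin (hu _ ht)
  have h2 : ∀ {q : M} {t : ℝ}, t ∈ J → γ t ∈ (extChartAt 𝓘(ℝ, E) q).source →
      derivWithin (derivWithin (fun s => extChartAt 𝓘(ℝ, E) q (γ s)) J) J t
        = deriv (deriv (fun s => extChartAt 𝓘(ℝ, E) q (γ s))) t := by
    intro q t ht h
    have h3 : derivWithin (fun s => extChartAt 𝓘(ℝ, E) q (γ s)) J
        =ᶠ[𝓝[J] t] deriv (fun s => extChartAt 𝓘(ℝ, E) q (γ s)) := by
      filter_upwards [self_mem_nhdsWithin, nhdsWithin_le_nhds (hev h)] with s hs hs'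
      exact h1 hs hs'
    rw [h3.derivWithin_eq (h1 ht h)]
    have h4 : ContDiffAt ℝ ∞ (deriv (fun s => extChartAt 𝓘(ℝ, E) q (γ s))) t :=
      ((hsm h).fderiv_right (m := ∞) (by simp)).clm_apply (contDiffAt_const (c := (1 : ℝ)))
    exact (h4.differentiableAt (by simp)).derivWithin (hu _ ht)
  refine ⟨hJ, hJn, hγ.smooth.mono (subset_univ _), fun t ht q h => ?_, fun t ht q h => ?_⟩
  · rw [h1 ht h]
    have := hγ.velocity_ne_zero t (mem_univ _) q h
    rwa [derivWithin_univ] at this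
  · rw [h1 ht h, h2 ht h]
    have := hγ.equation t (mem_univ _) q h
    rwa [derivWithin_univ, derivWithin_univ] at this

end Restriction

/-! ### Separation of the quotient. -/

section Quotient

/-- The projection is open and its equivalence relation is the preimage of `H` under `(g, k) ↦ g⁻¹
k`, hence closed. The Hausdorff property is what the gluing in `IsGeodesicOn.eqOn` needs. -/
theorem t2Space_quotient_of_isClosed {G : Type*} [TopologicalSpace G] [Group G]
    [IsTopologicalGroup G] {H : Subgroup G} (hH : IsClosed (H : Set G)) : T2Space (G ⧸ H) := by
  rw [t2Space_iff_of_isOpenQuotientMap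
    (QuotientGroup.isOpenQuotientMap_mk : IsOpenQuotientMap (QuotientGroup.mk : G → G ⧸ H))]
  have h : {p : G × G | (QuotientGroup.mk p.1 : G ⧸ H) = QuotientGroup.mk p.2}
      = (fun p : G × G => p.1⁻¹ * p.2) ⁻¹' (H : Set G) := by
    ext p
    exact QuotientGroup.eq
  rw [h]
  exact hH.preimage (by fun_prop)

end Quotient

/-! ### Geodesic orbits in every direction, and the main theorem. -/

section Homogeneous

variable {EG : Type*} [NormedAddCommGroup EG] [NormedSpace ℝ EG]
  {G : Type*} [TopologicalSpace G] [ChartedSpace EG G] [Group G] [LieGroup 𝓘(ℝ, EG) ∞ G]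

theorem IsOneParameterSubgroup.exists_conj {X : GroupLieAlgebra 𝓘(ℝ, EG) G} {c : ℝ → G}
    (hc : IsOneParameterSubgroup X c) (a : G) :
    ∃ Y : GroupLieAlgebra 𝓘(ℝ, EG) G, IsOneParameterSubgroup Y fun t => a * c t * a⁻¹ :=
  ⟨(mfderiv 𝓘(ℝ, ℝ) 𝓘(ℝ, EG) (fun t => a * c t * a⁻¹) 0 (1 : ℝ) : EG),
    by rw [hc.map_zero, mul_one, mul_inv_cancel],
    fun s t => by rw [hc.map_add]; group,
    (contMDiff_const.mul hc.smooth).mul contMDiff_const, rfl⟩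

variable {H : Subgroup G}
  {E : Type*} [NormedAddCommGroup E] [NormedSpace ℝ E] [ChartedSpace E (G ⧸ H)]
  [IsManifold 𝓘(ℝ, E) ∞ (G ⧸ H)]
  {F : TangentBundle 𝓘(ℝ, E) (G ⧸ H) → ℝ}

/-- Every nonzero tangent vector of a naturally reductive space is the velocity of an orbit of a
one-parameter subgroup, all of whose left translates project to geodesics. -/
theorem IsNaturallyReductive.exists_isGeodesicOn_orbit [FiniteDimensional ℝ EG] [T2Space G]
    (hF : IsFinslerMetric F) (hinv : IsInvariant H F)
    (hπ : Manifold.IsSubmersion 𝓘(ℝ, EG) 𝓘(ℝ, E) ∞ (QuotientGroup.mk : G → G ⧸ H))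
    (hnr : IsNaturallyReductive EG H F) {q : G ⧸ H} {a : G}
    (h : (QuotientGroup.mk a : G ⧸ H) ∈ (extChartAt 𝓘(ℝ, E) q).source) {v : E} (hv : v ≠ 0) :
    ∃ (X : GroupLieAlgebra 𝓘(ℝ, EG) G) (c : ℝ → G), IsOneParameterSubgroup X c ∧
      orbitDeriv EG E q a (X : EG) = v ∧
      ∀ b : G, IsGeodesicOn F univ (fun t => (QuotientGroup.mk (b * c t) : G ⧸ H)) := by
  obtain ⟨𝔥, m, hm, hh, -, hred⟩ := hnr
  obtain ⟨W, hW⟩ := orbitDeriv_surjective hπ h v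
  -- The component in `𝔥` is invisible in the quotient, so the `𝔪`-component of a lift of `v` is
  -- again a lift; stationarity is known for vectors of `𝔪`.
  obtain ⟨X, hX, V, hV, hXV⟩ : ∃ y ∈ m, ∃ z ∈ 𝔥, y + z = W :=
    Submodule.mem_sup.1 (by rw [hm.sup_eq_top]; trivial)
  have hV0 : orbitDeriv EG E q a (V : EG) = 0 :=
    (orbitDeriv_eq_zero_iff hF hinv hπ.contMDiff h _).2
      (originNorm_eq_zero_of_memLieAlgebra hF hinv hπ.contMDiff ((hh V).1 hV))
  have hXv : orbitDeriv EG E q a (X : EG) = v := by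
    have h1 : orbitDeriv EG E q a W
        = orbitDeriv EG E q a (X : EG) + orbitDeriv EG E q a (V : EG) := by
      rw [← hXV]
      exact map_add (orbitDeriv EG E q a) (X : EG) (V : EG)
    rw [← hW, h1, hV0, add_zero]
  have hX0 : originNorm EG H F (X : EG) ≠ 0 := fun h0 =>
    hv (hXv.symm.trans ((orbitDeriv_eq_zero_iff hF hinv hπ.contMDiff h _).2 h0))
  obtain ⟨c, hc⟩ := exists_isOneParameterSubgroup X
  exact ⟨X, c, hc, hXv, hc.isGeodesicOn_orbit hF hinv hπ hX0
    (IsNaturallyReductive.fderiv_originNorm_bracket hF hinv hπ.contMDiff hh hred hX hX0)⟩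

end Homogeneous

end FinslerHomogeneous

theorem theorem3p12
    {EG : Type*} [NormedAddCommGroup EG] [NormedSpace ℝ EG] [FiniteDimensional ℝ EG]
    {G : Type*} [TopologicalSpace G] [T2Space G] [ChartedSpace EG G] [Group G]
    [LieGroup 𝓘(ℝ, EG) ∞ G]
    (H : Subgroup G) (hH : IsClosed (H : Set G))
    {E : Type*} [NormedAddCommGroup E] [NormedSpace ℝ E] [FiniteDimensional ℝ E]
    [ChartedSpace E (G ⧸ H)] [IsManifold 𝓘(ℝ, E) ∞ (G ⧸ H)]
    -- `G ⧸ H` carries the quotient manifold structure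
    (hπ : Manifold.IsSubmersion 𝓘(ℝ, EG) 𝓘(ℝ, E) ∞ (QuotientGroup.mk : G → G ⧸ H))
    (F : TangentBundle 𝓘(ℝ, E) (G ⧸ H) → ℝ)
    (hF : FinslerHomogeneous.IsFinslerMetric F)
    (hinv : FinslerHomogeneous.IsInvariant H F)
    (hnr : FinslerHomogeneous.IsNaturallyReductive EG H F)
    (J : Set ℝ) (γ : ℝ → G ⧸ H) (hγ : FinslerHomogeneous.IsGeodesicOn F J γ) :
    ∃ (X : GroupLieAlgebra 𝓘(ℝ, EG) G) (c : ℝ → G) (p : G ⧸ H),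
      FinslerHomogeneous.IsOneParameterSubgroup X c ∧
      (∀ t : ℝ, FinslerHomogeneous.IsIsometricMap F (fun x : G ⧸ H => c t • x)) ∧
      FinslerHomogeneous.IsGeodesicOn F Set.univ (fun t => c t • p) ∧
      ∀ t ∈ J, γ t = c t • p := by
  have := topologicalGroup_of_lieGroup 𝓘(ℝ, EG) (G := G) ∞
  have : T2Space (G ⧸ H) := FinslerHomogeneous.t2Space_quotient_of_isClosed hH
  obtain ⟨t₀, ht₀⟩ := hγ.nontrivial.nonempty
  obtain ⟨a, ha⟩ := QuotientGroup.mk_surjective (γ t₀)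
  have hq := mem_extChartAt_source (I := 𝓘(ℝ, E)) (γ t₀)
  have hqa : (QuotientGroup.mk a : G ⧸ H) ∈ (extChartAt 𝓘(ℝ, E) (γ t₀)).source := by
    rw [ha]
    exact hq
  obtain ⟨X, c, hc, hX, hgeo⟩ := hnr.exists_isGeodesicOn_orbit hF hinv hπ hqa
    (hγ.velocity_ne_zero t₀ ht₀ (γ t₀) hq)
  -- `X` was chosen for the velocity at time `t₀`; this shift makes `b c(t) H` pass through `aH` at
  -- `t = t₀` instead of `t = 0`.
  set b : G := a * c (-t₀) with hb
  have hbt : b * c t₀ = a := by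
    rw [hb, mul_assoc, ← hc.map_add, neg_add_cancel, hc.map_zero, mul_one]
  obtain ⟨Y, hY⟩ := hc.exists_conj b
  -- The translated curve is the orbit of `bH` under the conjugate one-parameter group, generated by
  -- `Y`.
  have hsmul : ∀ t, (b * c t * b⁻¹) • (QuotientGroup.mk b : G ⧸ H) = QuotientGroup.mk (b * c t) :=
    fun t => by
      change (QuotientGroup.mk (b * c t * b⁻¹ * b) : G ⧸ H) = _
      rw [inv_mul_cancel_right]
  refine ⟨Y, fun t => b * c t * b⁻¹, QuotientGroup.mk b, hY, fun t => hinv _, ?_, ?_⟩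
  · simp only [hsmul]
    exact hgeo b
  · simp only [hsmul]
    have hδ := (hgeo b).restrict hγ.ordConnected hγ.nontrivial
    refine hγ.eqOn hF hδ ht₀ hq (by rw [hbt, ha]) ?_
    have h1 := hc.hasDerivAt_extChartAt_mk_mul hπ.contMDiff (q := γ t₀) (b := b) (s := t₀)
      (by rwa [hbt])
    rw [hbt, hX] at h1
    exact (h1.hasDerivWithinAt.derivWithin (hγ.uniqueDiffOn t₀ ht₀)).symm
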